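/- Let $\mathbb K$ be an algebraically closed field of characteristic $0$ and let $\mathfrak g$, $V$ be vector spaces over $\mathbb K$ (of any dimension). Put $W=\mathfrak g\oplus V$. **Notation.** Let $L=\bigoplus_{p\ge 0}L^p$ with $L^p=\mathrm{Hom}(\wedge^{p}W\otimes W,W)$, and equip $L$ with the Matsushima–Nijenhuis bracket $[P,Q]^{MN}=P\circ Q-(-1)^{pq}Q\circ P$ for $P\in L^p$, $Q\in L^q$, where $$\begin{aligned}(P\circ Q)(x_1,\dots,x_{p+q+1})=&\sum_{\sigma\in S(q,1,p-1)}\mathrm{sgn}(\sigma)\,P\big(Q(x_{\sigma(1)},\dots,x_{\sigma(q+1)}),x_{\sigma(q+2)},\dots,x_{\sigma(p+q)},x_{p+q+1}\big)\\&+(-1)^{pq}\sum_{\sigma\in S(p,q)}\mathrm{sgn}(\sigma)\,P\big(x_{\sigma(1)},\dots,x_{\sigma(p)},Q(x_{\sigma(p+1)},\dots,x_{\sigma(p+q)},x_{p+q+1})\big);\end{aligned}$$ $S(i_1,\dots,i_r)$ denotes the unshuffles, and the first sum is empty for $p=0$. A map $f\in L^{k+l}$ has bidegree $k|l$ if, on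 arguments each taken from $\mathfrak g$ or from $V$, it takes values in $\mathfrak g$ when $k+1$ arguments are from $\mathfrak g$ and $l$ from $V$, takes values in $V$ when $k$ arguments are from $\mathfrak g$ and $l+1$ from $V$, and vanishes otherwise. Let $C^{k|l}\subset L^{k+l}$ be the space of such maps, and put $$L'=\bigoplus_{n\ge0}C^{n|0},\qquad \mathfrak h=\bigoplus_{n\ge1}C^{n|-1}\cong\bigoplus_{n\ge1}\mathrm{Hom}(\wedge^{n-1}\mathfrak g\otimes\mathfrak g,V).$$ Let $P:L\to L$ be the projection onto $\mathfrak h$ along the other bidegree components, and let $(s^{-1}L')^i=L'^{\,i+1}$. The higher derived brackets of $(L,\mathfrak h,P,\Delta=0)$, restricted to $s^{-1}L'\oplus\mathfrak h$, are $$l_1(s^{-1}f)=P(f),\qquad l_2(s^{-1}f,s^{-1}f')=(-1)^{|f|}s^{-1}[f,f']^{MN},\qquad l_k(s^{-1}f,\theta_1,\dots,\theta_{k-1})=P[\cdots[[f,\theta_1]^{MN},\theta_2]^{MN},\cdots,\theta_{k-1}]^{MN}\ (k\ge2)$$ for homogeneous $f,f'\in L'$ and $\theta_i\in\mathfrak h$,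 extended multilinearly and by graded symmetry, all other combinations being zero. **Conventions.** An $L_\infty$-algebra is a $\mathbb Z$-graded vector space with graded symmetric multilinear operations $l_k$ ($k\ge1$) of degree $1$ that satisfy, for all $n\ge 1$ and homogeneous $x_1,\dots,x_n$, $$\sum_{i=1}^n\sum_{\sigma\in S(i,n-i)}\varepsilon(\sigma)\,l_{n-i+1}(l_i(x_{\sigma(1)},\dots,x_{\sigma(i)}),x_{\sigma(i+1)},\dots,x_{\sigma(n)})=0,$$ where $\varepsilon(\sigma)$ is the Koszul sign. A Maurer–Cartan element is an element $\alpha$ of degree $0$ with $\sum_{k\ge1}\frac1{k!}l_k(\alpha,\dots,\alpha)=0$ (a finite sum). For linear maps $\pi:\mathfrak g\otimes\mathfrak g\to\mathfrak g$, $\rho,\mu:\mathfrak g\to\mathfrak{gl}(V)$ and $D:\mathfrak g\to V$, write $x\cdot y=\pi(x,y)$. One calls $(\mathfrak g,D,\rho,\mu)$ (with product $\pi$) a pre-LieDer pair if for all $x,y,z\in\mathfrak g$ * $(x\cdot y)\cdot z-x\cdot(y\cdot z)=(y\cdot x)\cdot z-y\cdot(x\cdot z)$ (that is, $(\mathfrak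 g,\pi)$ is a pre-Lie algebra); * $\rho(x\cdot y-y\cdot x)=\rho(x)\rho(y)-\rho(y)\rho(x)$ and $\mu(y)\mu(x)-\mu(x\cdot y)=\mu(y)\rho(x)-\rho(x)\mu(y)$ (that is, $(V;\rho,\mu)$ is a representation); * $D(x\cdot y)=\rho(x)D(y)+\mu(y)D(x)$ (that is, $D$ is a derivation). **Theorem.** With these brackets, $s^{-1}L'\oplus\mathfrak h$ is an $L_\infty$-algebra, and its brackets are given, for homogeneous $f,f'\in L'$ and $\theta,\theta'\in\mathfrak h$, by $$l_2(s^{-1}f,s^{-1}f')=(-1)^{|f|}s^{-1}[f,f']^{MN},\qquad l_2(s^{-1}f,\theta)=P([f,\theta]^{MN}),\qquad l_2(\theta,\theta')=0,$$ and $l_k=0$ for all $k\ne2$. Moreover, for all linear $\pi:\mathfrak g\otimes\mathfrak g\to\mathfrak g$, $\rho,\mu:\mathfrak g\to\mathfrak{gl}(V)$ and $D:\mathfrak g\to V$, regard $\pi+\rho+\mu\in C^{1|0}$ as the map $(x_1+v_1,x_2+v_2)\mapsto \pi(x_1,x_2)+\rho(x_1)v_2+\mu(x_2)v_1$ and $D\in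 C^{1|-1}$ as the map $x+v\mapsto D(x)$. Then $(s^{-1}(\pi+\rho+\mu),D)$ is a Maurer–Cartan element of this $L_\infty$-algebra if and only if $(\mathfrak g,D,\rho,\mu)$, with product $\pi$ on $\mathfrak g$, is a pre-LieDer pair. -/

import Mathlib

open scoped DirectSum

namespace PreLieDer

/-! ### Unshuffles -/

/-- A permutation `σ` of the positions `0, …, n - 1` is an unshuffle with respect to the division of
the positions into the consecutive blocks `{k | b k = c}` if `σ` is increasing on every block. -/
def IsUnshuffle {n : ℕ} (b : Fin n → ℕ) (σ : Equiv.Perm (Fin n)) : Prop :=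
  ∀ i j : Fin n, i < j → b i = b j → σ i < σ j

instance {n : ℕ} (b : Fin n → ℕ) : DecidablePred (IsUnshuffle b) := fun σ =>
  inferInstanceAs (Decidable (∀ i j : Fin n, i < j → b i = b j → σ i < σ j))

/-- The blocks of an `(i, n - i)`-unshuffle. -/
def blocksTwo (i n : ℕ) (k : Fin n) : ℕ := if (k : ℕ) < i then 0 else 1

/-- The blocks of a `(q, 1, n - q - 1)`-unshuffle. -/
def blocksThree (q n : ℕ) (k : Fin n) : ℕ :=
  if (k : ℕ) < q then 0 else if (k : ℕ) = q then 1 else 2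

theorem blocksTwo_monotone (i n : ℕ) : Monotone (blocksTwo i n) := by
  intro a b h
  have : (a : ℕ) ≤ b := h
  unfold blocksTwo
  split_ifs <;> omega

theorem blocksThree_monotone (q n : ℕ) : Monotone (blocksThree q n) := by
  intro a b h
  have : (a : ℕ) ≤ b := h
  unfold blocksThree
  split_ifs <;> omega

/-- Sorting the values of a permutation inside every block. -/
theorem exists_isUnshuffle_mul {n : ℕ} {b : Fin n → ℕ} (hb : Monotone b)
    (τ : Equiv.Perm (Fin n)) :
    ∃ h : Equiv.Perm (Fin n), (∀ i, b (h i) = b i) ∧ IsUnshuffle b (τ * h) := by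
  let key : Fin n → ℕ ×ₗ Fin n := fun i => toLex (b i, τ i)
  have hs : Monotone (key ∘ Tuple.sort key) := Tuple.monotone_sort key
  have h1 : Monotone (b ∘ Tuple.sort key) := by
    intro i j hij
    have := hs hij
    rcases (Prod.Lex.toLex_le_toLex.1 this) with h | h
    · exact h.le
    · exact h.1.le
  have h2 : b ∘ Tuple.sort key = b ∘ (1 : Equiv.Perm (Fin n)) :=
    Tuple.unique_monotone h1 (by simpa using hb)
  refine ⟨Tuple.sort key, fun i => congrFun h2 i, fun i j hij hbij => ?_⟩
  have h3 := hs hij.le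
  have e1 : b (Tuple.sort key i) = b i := congrFun h2 i
  have e2 : b (Tuple.sort key j) = b j := congrFun h2 j
  rcases (Prod.Lex.toLex_le_toLex.1 h3) with h | h
  · exact absurd h (by simp only [e1, e2, hbij]; exact lt_irrefl _)
  · refine lt_of_le_of_ne h.2 fun he => hij.ne ?_
    exact (Tuple.sort key).injective (τ.injective he)

theorem IsUnshuffle.eq_one {n : ℕ} {b : Fin n → ℕ} (hb : Monotone b)
    {σ h : Equiv.Perm (Fin n)} (hσ : IsUnshuffle b σ) (hh : ∀ i, b (h i) = b i)
    (hσh : IsUnshuffle b (σ * h)) : h = 1 := by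
  let key : Fin n → ℕ ×ₗ Fin n := fun i => toLex (b i, σ i)
  have m1 : Monotone (key ∘ (1 : Equiv.Perm (Fin n))) := by
    intro i j hij
    refine Prod.Lex.toLex_le_toLex.2 ?_
    rcases hij.eq_or_lt with rfl | hlt
    · exact Or.inr ⟨rfl, le_rfl⟩
    · rcases (hb hij).eq_or_lt with he | hl
      · exact Or.inr ⟨he, (hσ i j hlt he).le⟩
      · exact Or.inl hl
  have m2 : Monotone (key ∘ h) := by
    intro i j hij
    refine Prod.Lex.toLex_le_toLex.2 ?_
    simp only [hh]
    rcases hij.eq_or_lt with rfl | hlt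
    · exact Or.inr ⟨rfl, le_rfl⟩
    · rcases (hb hij).eq_or_lt with he | hl
      · exact Or.inr ⟨he, (hσh i j hlt he).le⟩
      · exact Or.inl hl
  have := Tuple.unique_monotone m2 m1
  ext i
  have h2 := congrArg (fun z => (ofLex z).2) (congrFun this i)
  exact congrArg Fin.val (σ.injective h2)

section Alternating

variable {K W N : Type*} [CommRing K] [AddCommGroup W] [Module K W] [AddCommGroup N] [Module K N]

/-- A multilinear map that vanishes as soon as two arguments in the same block coincide. -/
def IsBlockAlternating {n : ℕ} (b : Fin n → ℕ) (F : MultilinearMap K (fun _ : Fin n => W) N) :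
    Prop :=
  ∀ (v : Fin n → W) (i j : Fin n), i ≠ j → b i = b j → v i = v j → F v = 0

theorem IsBlockAlternating.map_swap {n : ℕ} {b : Fin n → ℕ}
    {F : MultilinearMap K (fun _ : Fin n => W) N} (hF : IsBlockAlternating b F)
    (v : Fin n → W) {i j : Fin n} (hij : i ≠ j) (hb : b i = b j) :
    F (v ∘ Equiv.swap i j) = - F v := by
  have key : ∀ x y : W, F (Function.update (Function.update v i x) j y)
      + F (Function.update (Function.update v i y) j x) = 0 := by
    intro x y
    have h0 : ∀ z : W, F (Function.update (Function.update v i z) j z) = 0 := fun z =>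
      hF _ i j hij hb (by simp [Function.update_of_ne hij])
    have h := h0 (x + y)
    rw [F.map_update_add, Function.update_comm hij, Function.update_comm hij,
      F.map_update_add, F.map_update_add] at h
    rw [Function.update_comm hij.symm, Function.update_comm hij.symm,
      Function.update_comm hij.symm, Function.update_comm hij.symm, h0, h0] at h
    rw [← h]; abel
  have e1 : Function.update (Function.update v i (v i)) j (v j) = v := by simp
  have e2 : Function.update (Function.update v i (v j)) j (v i) = v ∘ Equiv.swap i j := by
    funext k
    by_cases hkj : k = j
    · subst hkj; simp
    · by_cases hki : k = i
      · subst hki; simp [Function.update_of_ne hkj]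
      · simp [Function.update_of_ne hkj, Function.update_of_ne hki,
          Equiv.swap_apply_of_ne_of_ne hki hkj]
  have := key (v i) (v j)
  rw [e1, e2] at this
  exact eq_neg_of_add_eq_zero_right this

theorem IsBlockAlternating.map_perm {n : ℕ} {b : Fin n → ℕ}
    {F : MultilinearMap K (fun _ : Fin n => W) N} (hF : IsBlockAlternating b F) :
    ∀ (m : ℕ) (h : Equiv.Perm (Fin n)), h.support.card = m → (∀ i, b (h i) = b i) →
      ∀ v : Fin n → W, F (v ∘ h) = Equiv.Perm.sign h • F v := by
  intro m
  induction m using Nat.strong_induction_on with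
  | _ m ih =>
    intro h hm hh v
    by_cases h1 : h = 1
    · subst h1; simp
    · obtain ⟨x, hx⟩ : ∃ x, h x ≠ x := by
        by_contra! hc
        exact h1 (Equiv.ext hc)
      have hlt := Equiv.Perm.card_support_swap_mul hx
      have hsw : ∀ i, b (Equiv.swap x (h x) i) = b i := by
        intro i
        by_cases hi : i = x
        · subst hi; simp [hh]
        · by_cases hi' : i = h x
          · rw [hi']; simp [hh]
          · rw [Equiv.swap_apply_of_ne_of_ne hi hi']
      have := ih _ (hm ▸ hlt) (Equiv.swap x (h x) * h) rfl
        (fun i => by rw [Equiv.Perm.mul_apply, hsw, hh]) (v ∘ Equiv.swap x (h x))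
      rw [hF.map_swap v hx.symm (hh x).symm] at this
      have e : (v ∘ Equiv.swap x (h x)) ∘ (Equiv.swap x (h x) * h : Equiv.Perm (Fin n)) = v ∘ h := by
        funext k; simp
      rw [e] at this
      rw [this, Equiv.Perm.sign_mul, Equiv.Perm.sign_swap hx.symm]
      simp

/-- The signed sum over all unshuffles of a multilinear map that is alternating in every block. -/
def unshuffleSum {n : ℕ} (b : Fin n → ℕ) (hb : Monotone b)
    (F : MultilinearMap K (fun _ : Fin n => W) N) (hF : IsBlockAlternating b F) :
    W [⋀^Fin n]→ₗ[K] N where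
  toFun v := ∑ σ : Equiv.Perm (Fin n) with IsUnshuffle b σ,
    Equiv.Perm.sign σ • F (fun k => v (σ k))
  map_update_add' := by
    intro _ v i x y
    have h := (∑ σ : Equiv.Perm (Fin n) with IsUnshuffle b σ,
      Equiv.Perm.sign σ • F.domDomCongr σ).map_update_add v i x y
    simp only [sum_apply, smul_apply,
      MultilinearMap.domDomCongr_apply] at h
    convert h
  map_update_smul' := by
    intro _ v i c x
    have h := (∑ σ : Equiv.Perm (Fin n) with IsUnshuffle b σ,
      Equiv.Perm.sign σ • F.domDomCongr σ).map_update_smul v i c x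
    simp only [sum_apply, smul_apply,
      MultilinearMap.domDomCongr_apply] at h
    convert h
  map_eq_zero_of_eq' := by
    intro v i j hv hij
    choose s hs hsu using fun τ => exists_isUnshuffle_mul hb τ
    have hvs : v ∘ Equiv.swap i j = v := by
      funext k
      by_cases hki : k = i
      · subst hki; simp [hv]
      · by_cases hkj : k = j
        · subst hkj; simp [hv]
        · simp [Equiv.swap_apply_of_ne_of_ne hki hkj]
    have hterm : ∀ σ : Equiv.Perm (Fin n),
        F (fun k => v ((Equiv.swap i j * σ * s (Equiv.swap i j * σ)) k))
          = Equiv.Perm.sign (s (Equiv.swap i j * σ)) • F (fun k => v (σ k)) := by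
      intro σ
      rw [← hF.map_perm _ _ rfl (hs _)]
      congr 1
      funext k
      exact congrFun hvs _
    refine Finset.sum_involution
      (fun σ _ => Equiv.swap i j * σ * s (Equiv.swap i j * σ)) ?_ ?_ ?_ ?_
    · intro σ _
      rw [hterm, Equiv.Perm.sign_mul, Equiv.Perm.sign_mul, Equiv.Perm.sign_swap hij, smul_smul,
        mul_assoc, Int.units_mul_self, mul_one, neg_one_mul, Units.neg_smul, add_neg_cancel]
    · intro σ _ hne heq
      apply hne
      have h1 : s (Equiv.swap i j * σ) = σ⁻¹ * Equiv.swap i j * σ := by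
        have h2 : s (Equiv.swap i j * σ) = (Equiv.swap i j * σ)⁻¹ * σ := by
          rw [eq_inv_mul_iff_mul_eq]; exact heq
        rw [h2, mul_inv_rev, Equiv.swap_inv]
      have h3 := hs (Equiv.swap i j * σ) (σ.symm j)
      rw [h1] at h3
      simp only [Equiv.Perm.mul_apply, Equiv.Perm.inv_def, Equiv.apply_symm_apply,
        Equiv.swap_apply_right] at h3
      have h4 : F (fun k => v (σ k)) = 0 :=
        hF _ (σ.symm i) (σ.symm j) (fun h => hij (σ.symm.injective h)) h3 (by simpa using hv)
      rw [h4, smul_zero]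
    · intro σ _
      simpa using hsu _
    · intro σ hσ
      have hσ' : IsUnshuffle b σ := by simpa using hσ
      have hu := hsu (Equiv.swap i j * (Equiv.swap i j * σ * s (Equiv.swap i j * σ)))
      have e : Equiv.swap i j * (Equiv.swap i j * σ * s (Equiv.swap i j * σ))
          = σ * s (Equiv.swap i j * σ) := by
        rw [← mul_assoc, ← mul_assoc, Equiv.swap_mul_self, one_mul]
      rw [e, mul_assoc] at hu
      have := hσ'.eq_one hb (fun k => by rw [Equiv.Perm.mul_apply, hs, hs]) hu
      change Equiv.swap i j * (Equiv.swap i j * σ * s (Equiv.swap i j * σ))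
        * s (Equiv.swap i j * (Equiv.swap i j * σ * s (Equiv.swap i j * σ))) = σ
      rw [e, mul_assoc, this, mul_one]

end Alternating

/-! ### The Matsushima–Nijenhuis bracket -/

section Bracket

/-- `Hom(∧^p W ⊗ W, W)`, the cochains with `p + 1` arguments, written in curried form:
`P x y = P(x_1, …, x_p, y)`. -/
def Cochain (K W : Type*) [CommRing K] [AddCommGroup W] [Module K W] (p : ℕ) :=
  W [⋀^Fin p]→ₗ[K] (W →ₗ[K] W)

instance (K W : Type*) [CommRing K] [AddCommGroup W] [Module K W] (p : ℕ) :
    AddCommGroup (Cochain K W p) :=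
  inferInstanceAs (AddCommGroup (W [⋀^Fin p]→ₗ[K] (W →ₗ[K] W)))

instance (K W : Type*) [CommRing K] [AddCommGroup W] [Module K W] (p : ℕ) :
    Module K (Cochain K W p) :=
  inferInstanceAs (Module K (W [⋀^Fin p]→ₗ[K] (W →ₗ[K] W)))

instance (K W : Type*) [CommRing K] [AddCommGroup W] [Module K W] (p : ℕ) :
    FunLike (Cochain K W p) (Fin p → W) (W →ₗ[K] W) :=
  inferInstanceAs (FunLike (W [⋀^Fin p]→ₗ[K] (W →ₗ[K] W)) (Fin p → W) (W →ₗ[K] W))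

/-- The graded space `⨁_{n ≥ 1} Hom(∧^{n-1} W ⊗ W, W)`; the summand with index `p = n - 1` has
degree `p`. -/
abbrev CochainSpace (K W : Type*) [CommRing K] [AddCommGroup W] [Module K W] :=
  ⨁ p : ℕ, Cochain K W p

variable {K W : Type*} [CommRing K] [AddCommGroup W] [Module K W]

@[simp]
theorem Cochain.zero_apply {p : ℕ} (x : Fin p → W) : (0 : Cochain K W p) x = 0 := rfl

@[simp]
theorem Cochain.add_apply {p : ℕ} (P Q : Cochain K W p) (x : Fin p → W) :
    (P + Q) x = P x + Q x := rfl

@[simp]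
theorem Cochain.neg_apply {p : ℕ} (P : Cochain K W p) (x : Fin p → W) : (-P) x = -P x := rfl

@[simp]
theorem Cochain.sub_apply {p : ℕ} (P Q : Cochain K W p) (x : Fin p → W) :
    (P - Q) x = P x - Q x := rfl

@[simp]
theorem Cochain.smul_apply {p : ℕ} (c : K) (P : Cochain K W p) (x : Fin p → W) :
    (c • P) x = c • P x := rfl

theorem Cochain.apply_eq_zero_of_eq {p : ℕ} (P : Cochain K W p) (x : Fin p → W) {i j : Fin p}
    (h : x i = x j) (hij : i ≠ j) : P x = 0 :=
  AlternatingMap.map_eq_zero_of_eq P x h hij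

theorem Cochain.apply_eq_zero_of_coord {p : ℕ} (P : Cochain K W p) {x : Fin p → W} (i : Fin p)
    (h : x i = 0) : P x = 0 :=
  AlternatingMap.map_coord_zero P i h

@[ext]
theorem Cochain.ext {p : ℕ} {P Q : Cochain K W p} (h : ∀ x y, P x y = Q x y) : P = Q :=
  AlternatingMap.ext fun x => LinearMap.ext fun y => h x y

/-- `(z_1, …, z_{p+q+1}) ↦ P(Q(z_1, …, z_{q+1}), z_{q+2}, …, z_{p+q+1}, ·)`
for `P ∈ Hom(∧^{p+1} W ⊗ W, W)` and `Q ∈ Hom(∧^q W ⊗ W, W)`. -/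
def insertFirst {p q : ℕ} (P : Cochain K W (p + 1)) (Q : Cochain K W q) :
    MultilinearMap K (fun _ : Fin (p + 1 + q) => W) (W →ₗ[K] W) where
  toFun z := P (Fin.cons
    (Q (fun k : Fin q => z ⟨k, by omega⟩) (z ⟨q, by omega⟩))
    (fun k : Fin p => z ⟨q + 1 + k, by omega⟩))
  map_update_add' := by
    intro _ z i x y
    let G : MultilinearMap K (fun _ : Fin (p + 1 + q) => W) (W →ₗ[K] W) :=
      (((AlternatingMap.toMultilinearMapLM (S := K)) ∘ₗ P.curryLeft).compMultilinearMap
        Q.toMultilinearMap.uncurryRight).uncurrySum.domDomCongr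
          (finSumFinEquiv.trans (finCongr (by omega : q + 1 + p = p + 1 + q)))
    have e : ∀ z : Fin (p + 1 + q) → W, P (Fin.cons
        (Q (fun k : Fin q => z ⟨k, by omega⟩) (z ⟨q, by omega⟩))
        (fun k : Fin p => z ⟨q + 1 + k, by omega⟩)) = G z := fun z => rfl
    simp only [e]
    exact G.map_update_add z i x y
  map_update_smul' := by
    intro _ z i c x
    let G : MultilinearMap K (fun _ : Fin (p + 1 + q) => W) (W →ₗ[K] W) :=
      (((AlternatingMap.toMultilinearMapLM (S := K)) ∘ₗ P.curryLeft).compMultilinearMap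
        Q.toMultilinearMap.uncurryRight).uncurrySum.domDomCongr
          (finSumFinEquiv.trans (finCongr (by omega : q + 1 + p = p + 1 + q)))
    have e : ∀ z : Fin (p + 1 + q) → W, P (Fin.cons
        (Q (fun k : Fin q => z ⟨k, by omega⟩) (z ⟨q, by omega⟩))
        (fun k : Fin p => z ⟨q + 1 + k, by omega⟩)) = G z := fun z => rfl
    simp only [e]
    exact G.map_update_smul z i c x

/-- `(z_1, …, z_{p+q}, y) ↦ P(z_1, …, z_p, Q(z_{p+1}, …, z_{p+q}, y))`
for `P ∈ Hom(∧^p W ⊗ W, W)` and `Q ∈ Hom(∧^q W ⊗ W, W)`. -/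
def insertLast {p q : ℕ} (P : Cochain K W p) (Q : Cochain K W q) :
    MultilinearMap K (fun _ : Fin (p + q) => W) (W →ₗ[K] W) where
  toFun z := P (fun k : Fin p => z ⟨k, by omega⟩) ∘ₗ Q (fun k : Fin q => z ⟨p + k, by omega⟩)
  map_update_add' := by
    intro _ z i x y
    let G : MultilinearMap K (fun _ : Fin (p + q) => W) (Module.End K W) :=
      ((LinearMap.mul' K (Module.End K W)).compMultilinearMap
        (MultilinearMap.domCoprod (N₁ := Module.End K W) (N₂ := Module.End K W)
          P.toMultilinearMap Q.toMultilinearMap)).domDomCongr finSumFinEquiv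
    have e : ∀ z : Fin (p + q) → W, P (fun k : Fin p => z ⟨k, by omega⟩) ∘ₗ
        Q (fun k : Fin q => z ⟨p + k, by omega⟩) = G z := fun z => rfl
    simp only [e]
    exact G.map_update_add z i x y
  map_update_smul' := by
    intro _ z i c x
    let G : MultilinearMap K (fun _ : Fin (p + q) => W) (Module.End K W) :=
      ((LinearMap.mul' K (Module.End K W)).compMultilinearMap
        (MultilinearMap.domCoprod (N₁ := Module.End K W) (N₂ := Module.End K W)
          P.toMultilinearMap Q.toMultilinearMap)).domDomCongr finSumFinEquiv
    have e : ∀ z : Fin (p + q) → W, P (fun k : Fin p => z ⟨k, by omega⟩) ∘ₗ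
        Q (fun k : Fin q => z ⟨p + k, by omega⟩) = G z := fun z => rfl
    simp only [e]
    exact G.map_update_smul z i c x

theorem insertFirst_isBlockAlternating {p q : ℕ} (P : Cochain K W (p + 1)) (Q : Cochain K W q) :
    IsBlockAlternating (blocksThree q (p + 1 + q)) (insertFirst P Q) := by
  intro v i j hij hb hv
  change P (Fin.cons _ _) = 0
  have hij' : (i : ℕ) ≠ j := fun h => hij (Fin.ext h)
  unfold blocksThree at hb
  by_cases hi : (i : ℕ) < q
  · have hj : (j : ℕ) < q := by lia
    rw [Q.apply_eq_zero_of_eq _ (i := ⟨i, hi⟩) (j := ⟨j, hj⟩) hv (by simpa using hij'),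
      LinearMap.zero_apply]
    exact P.apply_eq_zero_of_coord 0 rfl
  · have hi' : q < (i : ℕ) := by split_ifs at hb <;> omega
    have hj' : q < (j : ℕ) := by split_ifs at hb <;> omega
    have ei : (⟨q + 1 + (i - (q + 1)), by omega⟩ : Fin (p + 1 + q)) = i := Fin.ext (by lia)
    have ej : (⟨q + 1 + (j - (q + 1)), by omega⟩ : Fin (p + 1 + q)) = j := Fin.ext (by lia)
    refine P.apply_eq_zero_of_eq _ (i := Fin.succ ⟨i - (q + 1), by omega⟩)
      (j := Fin.succ ⟨j - (q + 1), by omega⟩) ?_ ?_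
    · simp only [Fin.cons_succ]
      rw [ei, ej, hv]
    · simp only [ne_eq, Fin.succ_inj, Fin.mk.injEq]
      omega

theorem insertLast_isBlockAlternating {p q : ℕ} (P : Cochain K W p) (Q : Cochain K W q) :
    IsBlockAlternating (blocksTwo p (p + q)) (insertLast P Q) := by
  intro v i j hij hb hv
  change P _ ∘ₗ Q _ = 0
  have hij' : (i : ℕ) ≠ j := fun h => hij (Fin.ext h)
  unfold blocksTwo at hb
  by_cases hi : (i : ℕ) < p
  · have hj : (j : ℕ) < p := by lia
    rw [P.apply_eq_zero_of_eq _ (i := ⟨i, hi⟩) (j := ⟨j, hj⟩) hv (by simpa using hij'),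
      LinearMap.zero_comp]
  · have hj : ¬ (j : ℕ) < p := by lia
    have ei : (⟨p + (i - p), by omega⟩ : Fin (p + q)) = i := Fin.ext (by lia)
    have ej : (⟨p + (j - p), by omega⟩ : Fin (p + q)) = j := Fin.ext (by lia)
    rw [Q.apply_eq_zero_of_eq _ (i := ⟨i - p, by omega⟩) (j := ⟨j - p, by omega⟩)
      (by simp only []; rw [ei, ej, hv]) (by simp only [ne_eq, Fin.mk.injEq]; omega),
      LinearMap.comp_zero]

/-- The part of `P ∘ Q` where `Q` is inserted into one of the first `p` arguments of `P`: the sum over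
`σ ∈ S(q, 1, p - 1)` of
`sgn(σ) P(Q(x_{σ(1)}, …, x_{σ(q+1)}), x_{σ(q+2)}, …, x_{σ(p+q)}, x_{p+q+1})`.
It is empty if `p = 0`. -/
def circFirst : {p q : ℕ} → Cochain K W p → Cochain K W q → Cochain K W (p + q)
  | 0, _, _, _ => 0
  | p + 1, q, P, Q => unshuffleSum (blocksThree q (p + 1 + q)) (blocksThree_monotone _ _)
      (insertFirst P Q) (insertFirst_isBlockAlternating P Q)

/-- The part of `P ∘ Q` where `Q` is inserted into the last argument of `P`, without the sign
`(-1)^{pq}`: the sum over `σ ∈ S(p, q)` of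
`sgn(σ) P(x_{σ(1)}, …, x_{σ(p)}, Q(x_{σ(p+1)}, …, x_{σ(p+q)}, x_{p+q+1}))`. -/
def circLast {p q : ℕ} (P : Cochain K W p) (Q : Cochain K W q) : Cochain K W (p + q) :=
  unshuffleSum (blocksTwo p (p + q)) (blocksTwo_monotone _ _)
    (insertLast P Q) (insertLast_isBlockAlternating P Q)

theorem circFirst_succ_apply {p q : ℕ} (P : Cochain K W (p + 1)) (Q : Cochain K W q)
    (x : Fin (p + 1 + q) → W) (y : W) :
    circFirst P Q x y =
      ∑ σ : Equiv.Perm (Fin (p + 1 + q)) with IsUnshuffle (blocksThree q (p + 1 + q)) σ,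
        Equiv.Perm.sign σ • P (Fin.cons
          (Q (fun k : Fin q => x (σ ⟨k, by omega⟩)) (x (σ ⟨q, by omega⟩)))
          (fun k : Fin p => x (σ ⟨q + 1 + k, by omega⟩))) y := by
  change (∑ σ : Equiv.Perm (Fin (p + 1 + q)) with IsUnshuffle (blocksThree q (p + 1 + q)) σ,
        Equiv.Perm.sign σ • P (Fin.cons
          (Q (fun k : Fin q => x (σ ⟨k, by omega⟩)) (x (σ ⟨q, by omega⟩)))
          (fun k : Fin p => x (σ ⟨q + 1 + k, by omega⟩)))) y = _
  rw [LinearMap.sum_apply]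
  rfl

theorem circLast_apply {p q : ℕ} (P : Cochain K W p) (Q : Cochain K W q)
    (x : Fin (p + q) → W) (y : W) :
    circLast P Q x y =
      ∑ σ : Equiv.Perm (Fin (p + q)) with IsUnshuffle (blocksTwo p (p + q)) σ,
        Equiv.Perm.sign σ • P (fun k : Fin p => x (σ ⟨k, by omega⟩))
          (Q (fun k : Fin q => x (σ ⟨p + k, by omega⟩)) y) := by
  change (∑ σ : Equiv.Perm (Fin (p + q)) with IsUnshuffle (blocksTwo p (p + q)) σ,
        Equiv.Perm.sign σ • (P (fun k : Fin p => x (σ ⟨k, by omega⟩)) ∘ₗ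
          (Q (fun k : Fin q => x (σ ⟨p + k, by omega⟩))))) y = _
  rw [LinearMap.sum_apply]
  rfl

/-- The composition `P ∘ Q` of cochains of degrees `p` and `q`, as a bilinear map. -/
def circ (p q : ℕ) : Cochain K W p →ₗ[K] Cochain K W q →ₗ[K] Cochain K W (p + q) :=
  LinearMap.mk₂ K (fun P Q => circFirst P Q + (-1 : K) ^ (p * q) • circLast P Q)
    (by
      intro P P' Q
      have h1 : circFirst (P + P') Q = circFirst P Q + circFirst P' Q := by
        rcases p with _ | p
        · exact (add_zero _).symm
        · ext x y
          simp [circFirst_succ_apply, Finset.sum_add_distrib]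
      have h2 : circLast (P + P') Q = circLast P Q + circLast P' Q := by
        ext x y
        simp [circLast_apply, Finset.sum_add_distrib]
      rw [h1, h2, smul_add]
      abel)
    (by
      intro c P Q
      have h1 : circFirst (c • P) Q = c • circFirst P Q := by
        rcases p with _ | p
        · exact (smul_zero _).symm
        · ext x y
          simp [circFirst_succ_apply, Finset.smul_sum, smul_comm c]
      have h2 : circLast (c • P) Q = c • circLast P Q := by
        ext x y
        simp [circLast_apply, Finset.smul_sum, smul_comm c]
      rw [h1, h2, smul_add, smul_comm c])
    (by
      intro P Q Q'
      have h1 : circFirst P (Q + Q') = circFirst P Q + circFirst P Q' := by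
        rcases p with _ | p
        · exact (add_zero _).symm
        · ext x y
          have e (u u' : W) (z : Fin p → W) : P (Fin.cons (u + u') z)
              = P (Fin.cons u z) + P (Fin.cons u' z) := P.map_vecCons_add z u u'
          simp [circFirst_succ_apply, Finset.sum_add_distrib, e]
      have h2 : circLast P (Q + Q') = circLast P Q + circLast P Q' := by
        ext x y
        simp [circLast_apply, Finset.sum_add_distrib]
      rw [h1, h2, smul_add]
      abel)
    (by
      intro c P Q
      have h1 : circFirst P (c • Q) = c • circFirst P Q := by
        rcases p with _ | p
        · exact (smul_zero _).symm
        · ext x y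
          have e (u : W) (z : Fin p → W) : P (Fin.cons (c • u) z)
              = c • P (Fin.cons u z) := P.map_vecCons_smul z c u
          simp [circFirst_succ_apply, Finset.smul_sum, smul_comm c, e]
      have h2 : circLast P (c • Q) = c • circLast P Q := by
        ext x y
        simp [circLast_apply, Finset.smul_sum, smul_comm c]
      rw [h1, h2, smul_add, smul_comm c])

/-- The Matsushima–Nijenhuis bracket `[P, Q] = P ∘ Q - (-1)^{pq} Q ∘ P` of cochains `P` of degree `p`
and `Q` of degree `q`. -/
def mnBracketHom (p q : ℕ) : Cochain K W p →ₗ[K] Cochain K W q →ₗ[K] CochainSpace K W :=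
  LinearMap.mk₂ K
    (fun P Q => DirectSum.lof K ℕ (Cochain K W) (p + q) (circ p q P Q)
      - (-1 : K) ^ (p * q) • DirectSum.lof K ℕ (Cochain K W) (q + p) (circ q p Q P))
    (fun P P' Q => by simp only [map_add, LinearMap.add_apply, smul_add]; abel)
    (fun c P Q => by
      simp only [map_smul, LinearMap.smul_apply, smul_sub, smul_comm c])
    (fun P Q Q' => by simp only [map_add, LinearMap.add_apply, smul_add]; abel)
    (fun c P Q => by
      simp only [map_smul, LinearMap.smul_apply, smul_sub, smul_comm c])

/-- The Matsushima–Nijenhuis bracket, extended bilinearly to the direct sum of all cochains. -/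
def mnBracket : CochainSpace K W →ₗ[K] CochainSpace K W →ₗ[K] CochainSpace K W :=
  DirectSum.toModule K ℕ _ fun p =>
    LinearMap.flip <| DirectSum.toModule K ℕ _ fun q => LinearMap.flip (mnBracketHom p q)

theorem mnBracket_lof_lof (p q : ℕ) (P : Cochain K W p) (Q : Cochain K W q) :
    mnBracket (DirectSum.lof K ℕ (Cochain K W) p P) (DirectSum.lof K ℕ (Cochain K W) q Q)
      = DirectSum.lof K ℕ (Cochain K W) (p + q) (circ p q P Q)
        - (-1 : K) ^ (p * q) • DirectSum.lof K ℕ (Cochain K W) (q + p) (circ q p Q P) := by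
  simp [mnBracket, mnBracketHom]

end Bracket

/-! ### Bidegrees on `g ⊕ V` -/

section Bidegree

variable {K g V : Type*} [CommRing K] [AddCommGroup g] [Module K g] [AddCommGroup V] [Module K V]

/-- The two summands of `g ⊕ V`: `g` for `false`, `V` for `true`. -/
def summand (K g V : Type*) [CommRing K] [AddCommGroup g] [Module K g] [AddCommGroup V]
    [Module K V] : Bool → Submodule K (g × V)
  | false => Submodule.prod ⊤ ⊥
  | true => Submodule.prod ⊥ ⊤

/-- The number of arguments of type `e`, where `c` lists the types of the first `p` arguments
and `d` is the type of the last one. -/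
def numType {p : ℕ} (e : Bool) (c : Fin p → Bool) (d : Bool) : ℕ :=
  (Finset.univ.filter fun i => c i = e).card + if d = e then 1 else 0

/-- `f` has bidegree `k|l`: it has `k + l + 1` arguments, and, evaluated on arguments each of which
lies in `g` or in `V`, it takes values in `g` on `k + 1` arguments from `g` and `l` from `V`, takes
values in `V` on `k` arguments from `g` and `l + 1` from `V`, and vanishes in all other cases. -/
def HasBidegree (k l : ℤ) {p : ℕ} (f : Cochain K (g × V) p) : Prop :=
  k + l + 1 = (p : ℤ) + 1 ∧
  ∀ (c : Fin p → Bool) (d : Bool) (x : Fin p → g × V) (y : g × V),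
    (∀ i, x i ∈ summand K g V (c i)) → y ∈ summand K g V d →
    ((numType false c d : ℤ) = k + 1 ∧ (numType true c d : ℤ) = l →
      f x y ∈ summand K g V false) ∧
    ((numType false c d : ℤ) = k ∧ (numType true c d : ℤ) = l + 1 →
      f x y ∈ summand K g V true) ∧
    (¬ ((numType false c d : ℤ) = k + 1 ∧ (numType true c d : ℤ) = l) →
      ¬ ((numType false c d : ℤ) = k ∧ (numType true c d : ℤ) = l + 1) → f x y = 0)

theorem HasBidegree.zero {k l : ℤ} {p : ℕ} (h : k + l + 1 = (p : ℤ) + 1) :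
    HasBidegree k l (0 : Cochain K (g × V) p) :=
  ⟨h, fun _ _ _ _ _ _ => ⟨fun _ => Submodule.zero_mem _, fun _ => Submodule.zero_mem _,
    fun _ _ => rfl⟩⟩

theorem HasBidegree.add {k l : ℤ} {p : ℕ} {f f' : Cochain K (g × V) p}
    (hf : HasBidegree k l f) (hf' : HasBidegree k l f') : HasBidegree k l (f + f') := by
  refine ⟨hf.1, fun c d x y hx hy => ?_⟩
  obtain ⟨h1, h2, h3⟩ := hf.2 c d x y hx hy
  obtain ⟨h1', h2', h3'⟩ := hf'.2 c d x y hx hy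
  refine ⟨fun h => Submodule.add_mem _ (h1 h) (h1' h),
    fun h => Submodule.add_mem _ (h2 h) (h2' h), fun h h' => ?_⟩
  change f x y + f' x y = 0
  rw [h3 h h', h3' h h', add_zero]

theorem HasBidegree.smul {k l : ℤ} {p : ℕ} (a : K) {f : Cochain K (g × V) p}
    (hf : HasBidegree k l f) : HasBidegree k l (a • f) := by
  refine ⟨hf.1, fun c d x y hx hy => ?_⟩
  obtain ⟨h1, h2, h3⟩ := hf.2 c d x y hx hy
  refine ⟨fun h => Submodule.smul_mem _ _ (h1 h),
    fun h => Submodule.smul_mem _ _ (h2 h), fun h h' => ?_⟩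
  change a • f x y = 0
  rw [h3 h h', smul_zero]

/-- The subspace `⨁_p C^{p + j | -j}` of the space of all cochains of `g ⊕ V`. -/
def bidegreeSpace (K g V : Type*) [CommRing K] [AddCommGroup g] [Module K g] [AddCommGroup V]
    [Module K V] (j : ℤ) : Submodule K (CochainSpace K (g × V)) where
  carrier := {f | ∀ p : ℕ, HasBidegree ((p : ℤ) + j) (-j) (f p)}
  zero_mem' := fun p => HasBidegree.zero (by ring)
  add_mem' := fun h h' p => (h p).add (h' p)
  smul_mem' := fun a _ h p => (h p).smul a

/-- `L' = ⨁_{n ≥ 0} C^{n|0}(g ⊕ V, g ⊕ V)`. -/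
abbrev LPrime (K g V : Type*) [CommRing K] [AddCommGroup g] [Module K g] [AddCommGroup V]
    [Module K V] : Submodule K (CochainSpace K (g × V)) :=
  bidegreeSpace K g V 0

/-- `h = ⨁_{n ≥ 1} C^{n|-1}(g ⊕ V, g ⊕ V)`, that is `⨁_{n ≥ 1} Hom(∧^{n-1} g ⊗ g, V)`;
the summand with index `n` has degree `n - 1`. -/
abbrev HSpace (K g V : Type*) [CommRing K] [AddCommGroup g] [Module K g] [AddCommGroup V]
    [Module K V] : Submodule K (CochainSpace K (g × V)) :=
  bidegreeSpace K g V 1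

/-- The summands of `g ⊕ V` indexed by weight: `g` has weight `0` and `V` has weight `1`. -/
def weightSummand (K g V : Type*) [CommRing K] [AddCommGroup g] [Module K g] [AddCommGroup V]
    [Module K V] (w : ℤ) : Submodule K (g × V) :=
  if w = 0 then summand K g V false else if w = 1 then summand K g V true else ⊥

/-- `f` lowers the total weight by `l`. -/
def LowersWeight (l : ℤ) {p : ℕ} (f : Cochain K (g × V) p) : Prop :=
  ∀ (w : Fin p → ℤ) (u : ℤ) (x : Fin p → g × V) (y : g × V),
    (∀ i, x i ∈ weightSummand K g V (w i)) → y ∈ weightSummand K g V u →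
    f x y ∈ weightSummand K g V (∑ i, w i + u - l)

theorem numType_true {p : ℕ} (c : Fin p → Bool) (d : Bool) :
    (numType true c d : ℤ) = ∑ i, (if c i = true then 1 else 0) + if d = true then 1 else 0 := by
  unfold numType
  push_cast
  rw [Finset.card_filter]
  push_cast
  rfl

theorem numType_false_add_true {p : ℕ} (c : Fin p → Bool) (d : Bool) :
    numType false c d + numType true c d = p + 1 := by
  unfold numType
  have h := Finset.card_filter_add_card_filter_not (s := (Finset.univ : Finset (Fin p)))
    (fun i => c i = false)
  simp only [Bool.not_eq_false, Finset.card_univ, Fintype.card_fin] at h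
  cases d <;> simp <;> omega

theorem hasBidegree_iff {k l : ℤ} {p : ℕ} {f : Cochain K (g × V) p} :
    HasBidegree k l f ↔ k + l = p ∧ LowersWeight l f := by
  constructor
  · rintro ⟨hkl, hf⟩
    refine ⟨by omega, fun w u x y hx hy => ?_⟩
    by_cases hw : ∀ i, w i = 0 ∨ w i = 1
    · by_cases hu : u = 0 ∨ u = 1
      · have hx' : ∀ i, x i ∈ summand K g V (decide (w i = 1)) := by
          intro i
          have := hx i
          rcases hw i with h | h <;> simpa [weightSummand, h] using this
        have hy' : y ∈ summand K g V (decide (u = 1)) := by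
          rcases hu with h | h <;> simpa [weightSummand, h] using hy
        obtain ⟨h1, h2, h3⟩ := hf _ _ x y hx' hy'
        have ht := numType_true (fun i => decide (w i = 1)) (decide (u = 1))
        have hs := numType_false_add_true (fun i => decide (w i = 1)) (decide (u = 1))
        have e1 : ∑ i, (if decide (w i = 1) = true then (1 : ℤ) else 0) = ∑ i, w i :=
          Finset.sum_congr rfl fun i _ => by rcases hw i with h | h <;> simp [h]
        have e2 : (if decide (u = 1) = true then (1 : ℤ) else 0) = u := by
          rcases hu with h | h <;> simp [h]
        rw [e1, e2] at ht
        unfold weightSummand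
        split_ifs with c1 c2
        · exact h1 ⟨by omega, by omega⟩
        · exact h2 ⟨by omega, by omega⟩
        · exact (Submodule.mem_bot K).2 (h3 (by omega) (by omega))
      · have : y = 0 := by
          rw [not_or] at hu
          simpa [weightSummand, hu.1, hu.2] using hy
        rw [this, map_zero]
        exact Submodule.zero_mem _
    · push Not at hw
      obtain ⟨i, hi⟩ := hw
      have : x i = 0 := by simpa [weightSummand, hi.1, hi.2] using hx i
      rw [f.apply_eq_zero_of_coord i this]
      exact Submodule.zero_mem _
  · rintro ⟨hkl, hf⟩
    refine ⟨by omega, fun c d x y hx hy => ?_⟩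
    have := hf (fun i => if c i = true then 1 else 0) (if d = true then 1 else 0) x y
      (fun i => by have := hx i; cases h : c i <;> simpa [weightSummand, h] using this)
      (by cases d <;> simpa [weightSummand] using hy)
    rw [← numType_true] at this
    have hs := numType_false_add_true c d
    unfold weightSummand at this
    refine ⟨fun h => ?_, fun h => ?_, fun h h' => ?_⟩
    · rwa [if_pos (by omega)] at this
    · rwa [if_neg (by omega), if_pos (by omega)] at this
    · rwa [if_neg (by omega), if_neg (by omega), Submodule.mem_bot] at this

theorem LowersWeight.circFirst {l m : ℤ} {p q : ℕ} {P : Cochain K (g × V) p}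
    {Q : Cochain K (g × V) q} (hP : LowersWeight l P) (hQ : LowersWeight m Q) :
    LowersWeight (l + m) (circFirst P Q) := by
  rcases p with _ | p
  · intro w u x y _ _
    exact Submodule.zero_mem _
  intro w u x y hx hy
  rw [circFirst_succ_apply]
  refine Submodule.sum_mem _ fun σ _ => ?_
  rw [Units.smul_def]
  refine zsmul_mem ?_ _
  have h1 := hQ (fun k : Fin q => w (σ ⟨k, by omega⟩)) (w (σ ⟨q, by omega⟩)) _ _
    (fun k => hx (σ ⟨k, by omega⟩)) (hx (σ ⟨q, by omega⟩))
  have h2 := hP (Fin.cons (∑ k : Fin q, w (σ ⟨k, by omega⟩) + w (σ ⟨q, by omega⟩) - m)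
    (fun k : Fin p => w (σ ⟨q + 1 + k, by omega⟩))) u (Fin.cons
          (Q (fun k : Fin q => x (σ ⟨k, by omega⟩)) (x (σ ⟨q, by omega⟩)))
          (fun k : Fin p => x (σ ⟨q + 1 + k, by omega⟩))) y
    (fun k => by
      refine Fin.cases ?_ (fun k => ?_) k
      · simpa using h1
      · simpa using hx (σ ⟨q + 1 + k, by omega⟩)) hy
  convert h2 using 2
  rw [Fin.sum_univ_succ]
  simp only [Fin.cons_zero, Fin.cons_succ]
  rw [← Equiv.sum_comp σ w,
    ← Equiv.sum_comp (finCongr (by omega : q + 1 + p = p + 1 + q)) (fun i => w (σ i)),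
    Fin.sum_univ_add, Fin.sum_univ_castSucc]
  simp only [finCongr_apply]
  change ∑ k : Fin q, w (σ ⟨k, by omega⟩) + w (σ ⟨q, by omega⟩)
    + ∑ k : Fin p, w (σ ⟨q + 1 + k, by omega⟩) + u - (l + m) = _
  ring

theorem LowersWeight.circLast {l m : ℤ} {p q : ℕ} {P : Cochain K (g × V) p}
    {Q : Cochain K (g × V) q} (hP : LowersWeight l P) (hQ : LowersWeight m Q) :
    LowersWeight (l + m) (circLast P Q) := by
  intro w u x y hx hy
  rw [circLast_apply]
  refine Submodule.sum_mem _ fun σ _ => ?_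
  rw [Units.smul_def]
  refine zsmul_mem ?_ _
  have h1 := hQ (fun k : Fin q => w (σ ⟨p + k, by omega⟩)) u _ _
    (fun k => hx (σ ⟨p + k, by omega⟩)) hy
  have h2 := hP (fun k : Fin p => w (σ ⟨k, by omega⟩)) _ _ _
    (fun k => hx (σ ⟨k, by omega⟩)) h1
  convert h2 using 2
  rw [← Equiv.sum_comp σ w, Fin.sum_univ_add]
  change ∑ k : Fin p, w (σ ⟨k, by omega⟩) + ∑ k : Fin q, w (σ ⟨p + k, by omega⟩) + u - (l + m) = _
  ring

theorem HasBidegree.circ {k l k' l' : ℤ} {p q : ℕ} {P : Cochain K (g × V) p}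
    {Q : Cochain K (g × V) q} (hP : HasBidegree k l P) (hQ : HasBidegree k' l' Q) :
    HasBidegree (k + k') (l + l') (circ p q P Q) := by
  rw [hasBidegree_iff] at hP hQ
  have h1 : HasBidegree (k + k') (l + l') (circFirst P Q) :=
    hasBidegree_iff.2 ⟨by push_cast; omega, hP.2.circFirst hQ.2⟩
  have h2 : HasBidegree (k + k') (l + l') (circLast P Q) :=
    hasBidegree_iff.2 ⟨by push_cast; omega, hP.2.circLast hQ.2⟩
  exact h1.add (h2.smul _)

theorem lof_mem_bidegreeSpace {j : ℤ} {p : ℕ} {f : Cochain K (g × V) p}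
    (hf : HasBidegree ((p : ℤ) + j) (-j) f) :
    DirectSum.lof K ℕ (Cochain K (g × V)) p f ∈ bidegreeSpace K g V j := by
  intro q
  by_cases h : p = q
  · subst h
    rwa [DirectSum.lof_apply]
  · rw [DirectSum.lof_eq_of, DirectSum.of_eq_of_ne _ _ _ (Ne.symm h)]
    exact HasBidegree.zero (by ring)

theorem mnBracket_lof_lof_mem {p q : ℕ} {P : Cochain K (g × V) p} {Q : Cochain K (g × V) q}
    (hP : HasBidegree ((p : ℤ) + 0) (-0) P) (hQ : HasBidegree ((q : ℤ) + 0) (-0) Q) :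
    mnBracket (DirectSum.lof K ℕ (Cochain K (g × V)) p P)
      (DirectSum.lof K ℕ (Cochain K (g × V)) q Q) ∈ LPrime K g V := by
  have h1 := hP.circ hQ
  have h2 := hQ.circ hP
  have e1 : (p : ℤ) + 0 + ((q : ℤ) + 0) = ((p + q : ℕ) : ℤ) + 0 := by push_cast; ring
  have e2 : (q : ℤ) + 0 + ((p : ℤ) + 0) = ((q + p : ℕ) : ℤ) + 0 := by push_cast; ring
  have e3 : (-0 : ℤ) + -0 = -0 := by norm_num
  rw [e1, e3] at h1
  rw [e2, e3] at h2
  rw [mnBracket_lof_lof]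
  exact Submodule.sub_mem _ (lof_mem_bidegreeSpace h1)
    (Submodule.smul_mem _ _ (lof_mem_bidegreeSpace h2))

/-- `L'` is closed under the Matsushima–Nijenhuis bracket. -/
theorem mnBracket_mem_LPrime {f f' : CochainSpace K (g × V)} (hf : f ∈ LPrime K g V)
    (hf' : f' ∈ LPrime K g V) : mnBracket f f' ∈ LPrime K g V := by
  classical
  have e1 := DirectSum.sum_support_of f
  have e2 := DirectSum.sum_support_of f'
  have e : mnBracket f f' = ∑ q ∈ DFinsupp.support f', ∑ p ∈ DFinsupp.support f,
      mnBracket (DirectSum.lof K ℕ (Cochain K (g × V)) p (f p))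
        (DirectSum.lof K ℕ (Cochain K (g × V)) q (f' q)) := by
    conv_lhs => rw [← e1, ← e2]
    simp only [map_sum, LinearMap.sum_apply]
    rfl
  rw [e]
  exact Submodule.sum_mem _ fun q _ => Submodule.sum_mem _ fun p _ =>
    mnBracket_lof_lof_mem (hf p) (hf' q)

/-- The projection of `Hom(∧^p (g ⊕ V) ⊗ (g ⊕ V), g ⊕ V)` onto its direct summand `C^{p+1|-1}`:
`(Pf)(x_1 + v_1, …, x_{p+1} + v_{p+1})` is the `V`-component of `f(x_1, …, x_{p+1})`. -/
def projCochain (p : ℕ) : Cochain K (g × V) p →ₗ[K] Cochain K (g × V) p where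
  toFun f :=
    { toFun := fun x => LinearMap.inr K g V ∘ₗ LinearMap.snd K g V ∘ₗ
        f (fun i => ((x i).1, 0)) ∘ₗ LinearMap.inl K g V ∘ₗ LinearMap.fst K g V
      map_update_add' := fun x i a b => by
        have h := (f.compLinearMap (LinearMap.inl K g V ∘ₗ LinearMap.fst K g V)).map_update_add
          x i a b
        have e : ∀ z : Fin p → g × V, f (fun i => ((z i).1, 0)) =
          f.compLinearMap (LinearMap.inl K g V ∘ₗ LinearMap.fst K g V) z := fun _ => rfl
        rw [e, e, e, h, LinearMap.add_comp, LinearMap.comp_add, LinearMap.comp_add]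
      map_update_smul' := fun x i a b => by
        have h := (f.compLinearMap (LinearMap.inl K g V ∘ₗ LinearMap.fst K g V)).map_update_smul
          x i a b
        have e : ∀ z : Fin p → g × V, f (fun i => ((z i).1, 0)) =
          f.compLinearMap (LinearMap.inl K g V ∘ₗ LinearMap.fst K g V) z := fun _ => rfl
        rw [e, e, h, LinearMap.smul_comp, LinearMap.comp_smul, LinearMap.comp_smul]
      map_eq_zero_of_eq' := fun x i j h hij => by
        rw [f.apply_eq_zero_of_eq _ (i := i) (j := j) (by simp only [h]) hij, LinearMap.zero_comp,
          LinearMap.comp_zero, LinearMap.comp_zero] }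
  map_add' f f' := by
    refine AlternatingMap.ext fun x => LinearMap.ext fun y => Prod.ext ?_ ?_
    · exact (add_zero (0 : g)).symm
    · rfl
  map_smul' a f := by
    refine AlternatingMap.ext fun x => LinearMap.ext fun y => Prod.ext ?_ ?_
    · exact (smul_zero a).symm
    · rfl

theorem projCochain_apply (p : ℕ) (f : Cochain K (g × V) p) (x : Fin p → g × V) (y : g × V) :
    projCochain p f x y = (0, (f (fun i => ((x i).1, 0)) (y.1, 0)).2) := rfl

/-- The projection `P` of the space of all cochains of `g ⊕ V` onto `h`. -/
def projH (K g V : Type*) [CommRing K] [AddCommGroup g] [Module K g] [AddCommGroup V]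
    [Module K V] : CochainSpace K (g × V) →ₗ[K] CochainSpace K (g × V) :=
  DirectSum.lmap projCochain

theorem projH_mem_HSpace (f : CochainSpace K (g × V)) : projH K g V f ∈ HSpace K g V := by
  intro p
  rw [projH, DirectSum.lmap_apply]
  refine ⟨by ring, fun c d x y hx hy => ?_⟩
  rw [projCochain_apply]
  have hs := numType_false_add_true c d
  refine ⟨fun h => by omega, fun _ => ?_, fun _ h => ?_⟩
  · simp [summand]
  · have : (∃ i, c i = true) ∨ d = true := by
      by_contra! hc
      apply h
      have h0 : numType true c d = 0 := by simp [numType, hc.1, hc.2]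
      omega
    rcases this with ⟨i, hi⟩ | hd
    · have := hx i
      rw [hi] at this
      have h1 : (x i).1 = 0 := by simpa [summand] using this
      rw [(f p).apply_eq_zero_of_coord i (by simp only [h1]; rfl)]
      simp
    · rw [hd] at hy
      have h1 : y.1 = 0 := by simpa [summand] using hy
      rw [h1, show ((0 : g), (0 : V)) = 0 from rfl, map_zero]
      rfl

end Bidegree

/-! ### `L_∞`-algebras and Maurer–Cartan elements -/

section LInfinity

variable {K A : Type*} [Field K] [AddCommGroup A] [Module K A]

/-- The Koszul sign `ε(σ; x_1, …, x_n)`, where `x_i` has degree `d i`: the product of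
`(-1)^{d(σ i) d(σ j)}` over all inversions `i < j`, `σ j < σ i`. -/
def koszulSign {n : ℕ} (d : Fin n → ℤ) (σ : Equiv.Perm (Fin n)) : ℤˣ :=
  ∏ i : Fin n, ∏ j : Fin n,
    if i < j ∧ σ j < σ i then Int.negOnePow (d (σ i) * d (σ j)) else 1

/-- The sequence `x_{σ(1)}, …, x_{σ(i)}`, for `i ≤ n`. -/
def permInit {n : ℕ} (x : Fin n → A) (σ : Equiv.Perm (Fin n)) (i : ℕ) (hi : i ≤ n) : Fin i → A :=
  fun k => x (σ (Fin.castLE hi k))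

/-- The sequence `x_{σ(i+1)}, …, x_{σ(n)}`. -/
def permTail {n : ℕ} (x : Fin n → A) (σ : Equiv.Perm (Fin n)) (i : ℕ) : Fin (n - i) → A :=
  fun k => x (σ ⟨i + k, by omega⟩)

/-- `A = ⨁_d 𝒜 d` with the operations `l 1, l 2, l 3, …` is an `L_∞`-algebra: the operations have
degree `1`, are graded symmetric, and satisfy the generalized Jacobi identities
`∑_{i=1}^n ∑_{σ ∈ S(i, n-i)} ε(σ) l_{n-i+1}(l_i(x_{σ(1)}, …, x_{σ(i)}), x_{σ(i+1)}, …, x_{σ(n)}) = 0`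
for homogeneous `x_1, …, x_n`. The value of `l 0` plays no role. -/
structure IsLInfinityAlgebra (𝒜 : ℤ → Submodule K A)
    (l : (n : ℕ) → MultilinearMap K (fun _ : Fin n => A) A) : Prop where
  isInternal : DirectSum.IsInternal 𝒜
  degree_one : ∀ n : ℕ, 1 ≤ n → ∀ (d : Fin n → ℤ) (x : Fin n → A), (∀ i, x i ∈ 𝒜 (d i)) →
    l n x ∈ 𝒜 (∑ i, d i + 1)
  graded_symmetry : ∀ n : ℕ, 1 ≤ n → ∀ (d : Fin n → ℤ) (x : Fin n → A), (∀ i, x i ∈ 𝒜 (d i)) →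
    ∀ σ : Equiv.Perm (Fin n), l n (fun i => x (σ i)) = koszulSign d σ • l n x
  generalized_jacobi : ∀ n : ℕ, 1 ≤ n → ∀ (d : Fin n → ℤ) (x : Fin n → A),
    (∀ i, x i ∈ 𝒜 (d i)) →
    ∑ i : Fin n, ∑ σ : Equiv.Perm (Fin n) with IsUnshuffle (blocksTwo (i + 1) n) σ,
      koszulSign d σ • l (n - (i + 1) + 1)
        (Fin.cons (l (i + 1) (permInit x σ (i + 1) i.isLt)) (permTail x σ (i + 1))) = 0

/-- `α` is a Maurer–Cartan element: it has degree `0`, only finitely many of the terms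
`l_k(α, …, α)`, `k ≥ 1`, are nonzero, and `∑_{k ≥ 1} (1 / k!) l_k(α, …, α) = 0`. -/
def IsMaurerCartan (𝒜 : ℤ → Submodule K A)
    (l : (n : ℕ) → MultilinearMap K (fun _ : Fin n => A) A) (α : A) : Prop :=
  α ∈ 𝒜 0 ∧ {k : ℕ | l (k + 1) (fun _ => α) ≠ 0}.Finite ∧
    ∑ᶠ k : ℕ, (((k + 1).factorial : K)⁻¹) • l (k + 1) (fun _ => α) = 0

end LInfinity

/-! ### Pre-Lie algebras, representations and derivations -/

section PreLie

variable {K g V : Type*} [CommRing K] [AddCommGroup g] [Module K g] [AddCommGroup V] [Module K V]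

/-- `(g, π)` is a pre-Lie algebra. -/
def IsPreLieAlgebra (π : g →ₗ[K] g →ₗ[K] g) : Prop :=
  ∀ x y z : g, π (π x y) z - π x (π y z) = π (π y x) z - π y (π x z)

/-- `(V; ρ, μ)` is a representation of `(g, π)`: `ρ` is a representation of the Lie algebra
`g` with bracket `[x, y] = π(x, y) - π(y, x)`, and `μ` is compatible with `ρ`. -/
structure IsRepresentation (π : g →ₗ[K] g →ₗ[K] g) (ρ μ : g →ₗ[K] Module.End K V) : Prop where
  rho_commutator : ∀ x y : g, ρ (π x y - π y x) = ρ x ∘ₗ ρ y - ρ y ∘ₗ ρ x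
  mu_compat : ∀ x y : g, μ y ∘ₗ μ x - μ (π x y) = μ y ∘ₗ ρ x - ρ x ∘ₗ μ y

/-- `D` is a derivation of `(g, π)` with respect to `(V; ρ, μ)`. -/
def IsDerivation (π : g →ₗ[K] g →ₗ[K] g) (ρ μ : g →ₗ[K] Module.End K V) (D : g →ₗ[K] V) : Prop :=
  ∀ x y : g, D (π x y) = ρ x (D y) + μ y (D x)

/-- `(g, D, ρ, μ)`, with the product `π` on `g`, is a pre-LieDer pair. -/
structure IsPreLieDerPair (π : g →ₗ[K] g →ₗ[K] g) (ρ μ : g →ₗ[K] Module.End K V)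
    (D : g →ₗ[K] V) : Prop where
  isPreLieAlgebra : IsPreLieAlgebra π
  isRepresentation : IsRepresentation π ρ μ
  isDerivation : IsDerivation π ρ μ D

end PreLie

/-! ### The higher derived brackets on `s⁻¹L' ⊕ h` -/

section DerivedBrackets

variable {K W : Type*} [CommRing K] [AddCommGroup W] [Module K W]

/-- The subspace of elements of degree `d` of the space of all cochains. -/
def homogeneous (K W : Type*) [CommRing K] [AddCommGroup W] [Module K W] (d : ℤ) :
    Submodule K (CochainSpace K W) where
  carrier := {f | ∀ p : ℕ, (p : ℤ) ≠ d → f p = 0}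
  zero_mem' := fun _ _ => rfl
  add_mem' := fun {f f'} h h' p hp => by rw [DirectSum.add_apply, h p hp, h' p hp, add_zero]
  smul_mem' := fun a f h p hp => by rw [DirectSum.smul_apply, h p hp, smul_zero]

/-- The map `f ↦ (-1)^{e |f|} f`. -/
def signMap (e : ℤ) : CochainSpace K W →ₗ[K] CochainSpace K W :=
  DirectSum.lmap fun p => ((Int.negOnePow (e * p) : ℤ) : K) • LinearMap.id

/-- The iterated bracket `(f, θ_1, …, θ_k) ↦ [⋯[[f, θ_1], θ_2], ⋯, θ_k]`. -/
def iteratedBracket : (k : ℕ) →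
    CochainSpace K W →ₗ[K] MultilinearMap K (fun _ : Fin k => CochainSpace K W) (CochainSpace K W)
  | 0 => (MultilinearMap.constLinearEquivOfIsEmpty (R := K) (S := K)
      (M₁ := fun _ : Fin 0 => CochainSpace K W) (M₂ := CochainSpace K W)).toLinearMap
  | k + 1 => (multilinearCurryLeftEquiv K (fun _ : Fin (k + 1) => CochainSpace K W)
      (CochainSpace K W)).symm.toLinearMap ∘ₗ mnBracket.compr₂ (iteratedBracket k)

theorem iteratedBracket_zero_apply (f : CochainSpace K W) (θ : Fin 0 → CochainSpace K W) :
    iteratedBracket 0 f θ = f := rfl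

theorem iteratedBracket_succ_apply (k : ℕ) (f : CochainSpace K W)
    (θ : Fin (k + 1) → CochainSpace K W) :
    iteratedBracket (k + 1) f θ = iteratedBracket k (mnBracket f (θ 0)) (Fin.tail θ) := rfl

variable (K) (g V : Type*) [AddCommGroup g] [Module K g] [AddCommGroup V] [Module K V]

/-- The space `s⁻¹L' ⊕ h`. -/
abbrev ControlSpace := LPrime K g V × HSpace K g V

/-- The grading of `s⁻¹L' ⊕ h`: in degree `d` it is `L'^{d+1} ⊕ h^d`. -/
def controlGrading (d : ℤ) : Submodule K (ControlSpace K g V) :=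
  ((homogeneous K (g × V) (d + 1)).comap (LPrime K g V).subtype).prod
    ((homogeneous K (g × V) d).comap (HSpace K g V).subtype)

/-- The projection `P`, as a map onto `h`. -/
def projToH : CochainSpace K (g × V) →ₗ[K] HSpace K g V :=
  (projH K g V).codRestrict (HSpace K g V) projH_mem_HSpace

theorem signMap_mem_LPrime (e : ℤ) {f : CochainSpace K (g × V)} (hf : f ∈ LPrime K g V) :
    signMap e f ∈ LPrime K g V := by
  intro p
  rw [signMap, DirectSum.lmap_apply]
  exact (hf p).smul _

/-- `(s⁻¹f, s⁻¹f') ↦ (-1)^{|f|} s⁻¹[f, f']` on `L'`, as a bilinear map. -/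
def shiftedBracket : LPrime K g V →ₗ[K] LPrime K g V →ₗ[K] LPrime K g V :=
  LinearMap.mk₂ K
    (fun f f' => ⟨mnBracket (signMap 1 f.1) f'.1,
      mnBracket_mem_LPrime (signMap_mem_LPrime K g V 1 f.2) f'.2⟩)
    (fun f₁ f₂ f' => Subtype.ext (by simp))
    (fun c f f' => Subtype.ext (by simp))
    (fun f f₁ f₂ => Subtype.ext (by simp))
    (fun c f f' => Subtype.ext (by simp))

/-- The component of the `k`-ary bracket in `s⁻¹L'`; it is nonzero only for `k = 2`. -/
def controlBracketShifted :
    (k : ℕ) → MultilinearMap K (fun _ : Fin k => ControlSpace K g V) (LPrime K g V)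
  | 2 => MultilinearMap.mk' (fun x => shiftedBracket K g V (x 0).1 (x 1).1)
      (fun x i a b => by fin_cases i <;> simp)
      (fun x i c a => by fin_cases i <;> simp)
  | _ => 0

/-- The multilinear map that sends `((s⁻¹f_0, θ_0), …, (s⁻¹f_k, θ_k))` to
`± [⋯[f_i, θ_0], ⋯, θ_k]`, where `θ_i` is left out and `±` is the Koszul sign, on homogeneous
elements, of moving `s⁻¹f_i`, which has degree `|f_i| - 1`, in front of `θ_0, …, θ_{i-1}`. -/
def derivedTerm (k : ℕ) (i : Fin (k + 1)) :
    MultilinearMap K (fun _ : Fin (k + 1) => ControlSpace K g V) (CochainSpace K (g × V)) :=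
  LinearMap.uncurryMid i
    ((DirectSum.toModule K ℕ _ fun p : ℕ =>
      (MultilinearMap.compLinearMapₗ fun j : Fin k =>
        (if i.succAbove j < i then signMap ((p : ℤ) - 1) else LinearMap.id) ∘ₗ
          (HSpace K g V).subtype ∘ₗ LinearMap.snd K (LPrime K g V) (HSpace K g V)) ∘ₗ
      iteratedBracket k ∘ₗ DirectSum.lof K ℕ (Cochain K (g × V)) p) ∘ₗ
    (LPrime K g V).subtype ∘ₗ LinearMap.fst K (LPrime K g V) (HSpace K g V))

/-- The brackets `l_k` on `s⁻¹L' ⊕ h` obtained from the V-data `(L, h, P, 0)` as higher derived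
brackets: `l_2(s⁻¹f, s⁻¹f') = (-1)^{|f|} s⁻¹[f, f']` and
`l_k(s⁻¹f, θ_1, …, θ_{k-1}) = P[⋯[f, θ_1], ⋯, θ_{k-1}]` for `k ≥ 1`, extended to all arguments by
multilinearity and graded symmetry, all other brackets being zero. -/
def controlBracket :
    (k : ℕ) → MultilinearMap K (fun _ : Fin k => ControlSpace K g V) (ControlSpace K g V)
  | 0 => 0
  | k + 1 =>
    (LinearMap.inl K (LPrime K g V) (HSpace K g V)).compMultilinearMap
        (controlBracketShifted K g V (k + 1)) +
      (LinearMap.inr K (LPrime K g V) (HSpace K g V) ∘ₗ projToH K g V).compMultilinearMap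
        (∑ i : Fin (k + 1), derivedTerm K g V k i)

end DerivedBrackets

/-! ### The elements `π + ρ + μ` and `D` -/

section Elements

variable {K g V : Type*} [CommRing K] [AddCommGroup g] [Module K g] [AddCommGroup V] [Module K V]

/-- A bilinear map on `W` as a cochain with two arguments. -/
def cochainOfBilinear {W : Type*} [AddCommGroup W] [Module K W] (B : W →ₗ[K] W →ₗ[K] W) :
    Cochain K W 1 :=
  AlternatingMap.ofSubsingleton K W (W →ₗ[K] W) (0 : Fin 1) B

theorem cochainOfBilinear_apply {W : Type*} [AddCommGroup W] [Module K W]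
    (B : W →ₗ[K] W →ₗ[K] W) (x : Fin 1 → W) (y : W) : cochainOfBilinear B x y = B (x 0) y := rfl

/-- The lift of `π ∈ Hom(g ⊗ g, g)`: `(x_1 + v_1, x_2 + v_2) ↦ π(x_1, x_2)`. -/
def liftPi (π : g →ₗ[K] g →ₗ[K] g) : Cochain K (g × V) 1 :=
  cochainOfBilinear ((π.compl₁₂ (LinearMap.fst K g V) (LinearMap.fst K g V)).compr₂
    (LinearMap.inl K g V))

/-- The lift of `ρ ∈ Hom(g ⊗ V, V)`: `(x_1 + v_1, x_2 + v_2) ↦ ρ(x_1) v_2`. -/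
def liftRho (ρ : g →ₗ[K] Module.End K V) : Cochain K (g × V) 1 :=
  cochainOfBilinear ((LinearMap.compl₁₂ (ρ : g →ₗ[K] V →ₗ[K] V)
    (LinearMap.fst K g V) (LinearMap.snd K g V)).compr₂ (LinearMap.inr K g V))

/-- The lift of `μ ∈ Hom(V ⊗ g, V)`: `(x_1 + v_1, x_2 + v_2) ↦ μ(x_2) v_1`. -/
def liftMu (μ : g →ₗ[K] Module.End K V) : Cochain K (g × V) 1 :=
  cochainOfBilinear ((LinearMap.compl₁₂ (LinearMap.flip (μ : g →ₗ[K] V →ₗ[K] V))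
    (LinearMap.snd K g V) (LinearMap.fst K g V)).compr₂ (LinearMap.inr K g V))

/-- The lift of `D ∈ Hom(g, V)`: `x + v ↦ D(x)`. -/
def liftD (D : g →ₗ[K] V) : Cochain K (g × V) 0 :=
  AlternatingMap.constOfIsEmpty K (g × V) (Fin 0)
    (LinearMap.inr K g V ∘ₗ D ∘ₗ LinearMap.fst K g V)

theorem liftPi_apply (π : g →ₗ[K] g →ₗ[K] g) (x : Fin 1 → g × V) (y : g × V) :
    liftPi π x y = (π (x 0).1 y.1, 0) := rfl

theorem liftRho_apply (ρ : g →ₗ[K] Module.End K V) (x : Fin 1 → g × V) (y : g × V) :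
    liftRho ρ x y = (0, ρ (x 0).1 y.2) := rfl

theorem liftMu_apply (μ : g →ₗ[K] Module.End K V) (x : Fin 1 → g × V) (y : g × V) :
    liftMu μ x y = (0, μ y.1 (x 0).2) := rfl

theorem liftD_apply (D : g →ₗ[K] V) (x : Fin 0 → g × V) (y : g × V) :
    liftD D x y = (0, D y.1) := rfl

theorem liftPi_add_liftRho_add_liftMu_hasBidegree (π : g →ₗ[K] g →ₗ[K] g)
    (ρ μ : g →ₗ[K] Module.End K V) :
    HasBidegree 1 0 (liftPi π + liftRho ρ + liftMu μ : Cochain K (g × V) 1) := by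
  refine ⟨by norm_num, fun c d x y hx hy => ?_⟩
  have hx0 := hx 0
  cases hc : c 0 <;> cases hd : d <;>
    simp_all [summand, numType, liftPi_apply, liftRho_apply, liftMu_apply, Finset.filter_singleton]

theorem liftD_hasBidegree (D : g →ₗ[K] V) :
    HasBidegree 1 (-1) (liftD D : Cochain K (g × V) 0) := by
  refine ⟨by norm_num, fun c d x y hx hy => ?_⟩
  cases hd : d <;> simp_all [summand, numType, liftD_apply]

/-- The element `π + ρ + μ` of `L'`. -/
def structureElement (π : g →ₗ[K] g →ₗ[K] g) (ρ μ : g →ₗ[K] Module.End K V) : LPrime K g V :=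
  ⟨DirectSum.lof K ℕ (Cochain K (g × V)) 1 (liftPi π + liftRho ρ + liftMu μ),
    lof_mem_bidegreeSpace (by simpa using liftPi_add_liftRho_add_liftMu_hasBidegree π ρ μ)⟩

/-- The element `D` of `h`. -/
def derivationElement (D : g →ₗ[K] V) : HSpace K g V :=
  ⟨DirectSum.lof K ℕ (Cochain K (g × V)) 0 (liftD D),
    lof_mem_bidegreeSpace (by simpa using liftD_hasBidegree D)⟩

end Elements

end PreLieDer

/-!
The proof rests on the fact that the composition `P ∘ Q` of cochains is a graded right pre-Lie
product, so that the Matsushima–Nijenhuis bracket satisfies the graded Jacobi identity.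

To see this without permutations, a cochain is regarded as a function on lists of arguments
(`toForm`). The signed sum over all ways to split a list into two sublists (`shuffleSum`) is
defined by recursion on the list; it is coassociative (`shuffleSum_assoc`) and graded
cocommutative (`shuffleSum_comm`), and the sums over unshuffles in the definition of `∘` are
instances of it (`permSum_blocksTwo`, `permSum_blocksThree`, `toForm_circ`), by the recursion on
the position of the first argument (`permSum_cons`). In these terms `P ∘ Q = i_{v_Q} P ± P Q`,
where `v_Q` is the vector-valued form `Q · id` and `i` denotes insertion. As `i` is a graded
derivation of the product (`insertForm_actForm`), `i_{v_R} v_Q = v_{Q ∘ R}`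
(`insertForm_vectorForm`), and the associator of `∘` reduces to terms that are graded symmetric in
`Q` and `R`, one of them being the simultaneous insertion of `v_Q` and `v_R`
(`insertForm_insertForm`, `insertPair_comm`).

Bidegrees add up under the bracket, hence `P L' = 0`, `[L', h] ⊆ h`, and `[h, h] = 0`. So
`l_k = 0` for `k ≠ 2` (`controlBracket_eq_zero`), and `l_2` is the bracket itself up to signs
(`controlBracket_two_of_mem`). The generalized Jacobi identities reduce to the one for `n = 3`,
whose two components follow from the graded Jacobi identity (`controlBracket_jacobi`). The
Maurer–Cartan equation becomes `[π + ρ + μ, π + ρ + μ] = 0` and `[π + ρ + μ, D] = 0`, which are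
the axioms of a pre-LieDer pair evaluated on `g ⊕ V`.
-/

namespace PreLieDer

/-! ### Signed splittings of lists -/

section SignedShuffle

variable {K W N N' : Type*} [CommRing K] [AddCommGroup N] [Module K N] [AddCommGroup N']
  [Module K N']

/-- The signed sum of `Φ a b` over all ways to distribute the entries of a list over two
sublists `a` and `b`, each in the original order; the sign is the one of the permutation that moves
the entries of `a` in front of those of `b`. -/
def shuffleSum (K : Type*) {W N : Type*} [CommRing K] [AddCommGroup N] [Module K N] :
    List W → (List W → List W → N) → N
  | [], Φ => Φ [] []
  | w :: l, Φ => shuffleSum K l (fun a b => Φ (w :: a) b) +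
      shuffleSum K l (fun a b => (-1 : K) ^ a.length • Φ a (w :: b))

theorem shuffleSum_nil (Φ : List W → List W → N) : shuffleSum K [] Φ = Φ [] [] := rfl

theorem shuffleSum_cons (w : W) (l : List W) (Φ : List W → List W → N) :
    shuffleSum K (w :: l) Φ = shuffleSum K l (fun a b => Φ (w :: a) b) +
      shuffleSum K l (fun a b => (-1 : K) ^ a.length • Φ a (w :: b)) := rfl

theorem shuffleSum_congr {l : List W} {Φ Ψ : List W → List W → N}
    (h : ∀ a b, a.length + b.length = l.length → Φ a b = Ψ a b) :
    shuffleSum K l Φ = shuffleSum K l Ψ := by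
  induction l generalizing Φ Ψ with
  | nil => exact h _ _ rfl
  | cons w l ih =>
    rw [shuffleSum_cons, shuffleSum_cons]
    congr 1
    · exact ih fun a b hab => h _ _ (by simp only [List.length_cons]; omega)
    · exact ih fun a b hab => by rw [h _ _ (by simp only [List.length_cons]; omega)]

theorem shuffleSum_add (l : List W) (Φ Ψ : List W → List W → N) :
    shuffleSum K l (fun a b => Φ a b + Ψ a b) = shuffleSum K l Φ + shuffleSum K l Ψ := by
  induction l generalizing Φ Ψ with
  | nil => rfl
  | cons w l ih =>
    simp only [shuffleSum_cons, smul_add, ih]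
    abel

theorem map_shuffleSum (φ : N →ₗ[K] N') (l : List W) (Φ : List W → List W → N) :
    φ (shuffleSum K l Φ) = shuffleSum K l (fun a b => φ (Φ a b)) := by
  induction l generalizing Φ with
  | nil => rfl
  | cons w l ih => simp only [shuffleSum_cons, map_add, ih, map_smul]

theorem shuffleSum_smul (c : K) (l : List W) (Φ : List W → List W → N) :
    shuffleSum K l (fun a b => c • Φ a b) = c • shuffleSum K l Φ :=
  (map_shuffleSum (c • LinearMap.id : N →ₗ[K] N) l Φ).symm

theorem shuffleSum_zero (l : List W) : shuffleSum K l (fun _ _ => (0 : N)) = 0 := by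
  simpa using shuffleSum_smul (0 : K) l (fun _ _ => (0 : N))

/-- A signed sum in which the second sublist has to be empty. -/
theorem shuffleSum_eq_nil (l : List W) (Φ : List W → N) :
    shuffleSum K l (fun a b => if b = [] then Φ a else 0) = Φ l := by
  induction l generalizing Φ with
  | nil => rfl
  | cons w l ih => simp [shuffleSum_cons, ih, shuffleSum_zero]

/-- Coassociativity of the signed unshuffling of a list. -/
theorem shuffleSum_assoc (l : List W) (Φ : List W → List W → List W → N) :
    shuffleSum K l (fun a d => shuffleSum K d (fun b c => Φ a b c)) =
      shuffleSum K l (fun d c => shuffleSum K d (fun a b => Φ a b c)) := by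
  induction l generalizing Φ with
  | nil => rfl
  | cons w l ih =>
    have e : shuffleSum K l (fun d c => (-1 : K) ^ d.length •
        shuffleSum K d (fun a b => Φ a b (w :: c))) =
        shuffleSum K l (fun d c => shuffleSum K d
          (fun a b => (-1 : K) ^ (a.length + b.length) • Φ a b (w :: c))) := by
      refine shuffleSum_congr fun d c _ => ?_
      rw [← shuffleSum_smul]
      exact shuffleSum_congr fun a b hab => by rw [hab]
    simp only [shuffleSum_cons, smul_add, shuffleSum_add, ← shuffleSum_smul, smul_smul] at e ⊢
    rw [e, ih, ih, ih, add_assoc]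
    congr 2
    refine shuffleSum_congr fun d c _ => shuffleSum_congr fun a b _ => ?_
    rw [pow_add]

/-- Graded cocommutativity of the signed unshuffling of a list. -/
theorem shuffleSum_comm (l : List W) (Φ : List W → List W → N) :
    shuffleSum K l Φ =
      shuffleSum K l (fun a b => (-1 : K) ^ (a.length * b.length) • Φ b a) := by
  induction l generalizing Φ with
  | nil => simp [shuffleSum_nil]
  | cons w l ih =>
    rw [shuffleSum_cons, shuffleSum_cons, ih, ih (fun a b => _ • Φ a (w :: b)), add_comm]
    congr 1
    · refine shuffleSum_congr fun a b _ => ?_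
      rw [smul_smul, ← pow_add, List.length_cons, add_mul, one_mul]
    · refine shuffleSum_congr fun a b _ => ?_
      rw [smul_smul, ← pow_add, List.length_cons, mul_add, mul_one, add_left_comm, ← two_mul,
        pow_add, pow_mul (-1 : K) 2]
      simp

/-- The insertion of a vector-valued form `α` into the first argument of a form `F`. -/
def insertForm (K : Type*) {W N : Type*} [CommRing K] [AddCommGroup N] [Module K N]
    (α : List W → W) (F : List W → N) (l : List W) : N :=
  shuffleSum K l (fun a b => F (α a :: b))

theorem insertForm_add_smul (c : K) (α : List W → W) (F F' : List W → N) (l : List W) :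
    insertForm K α (fun l => F l + c • F' l) l = insertForm K α F l + c • insertForm K α F' l := by
  simp only [insertForm, shuffleSum_add, shuffleSum_smul]

end SignedShuffle

/-! ### Insertions and products of forms -/

section Forms

variable {K W N : Type*} [CommRing K] [AddCommGroup W] [Module K W] [AddCommGroup N] [Module K N]

/-- A function on lists is concentrated in degree `p` if it vanishes on all lists whose length
is not `p`. -/
def IsConcentrated (p : ℕ) (F : List W → N) : Prop := ∀ l, l.length ≠ p → F l = 0

/-- The product of an endomorphism-valued form with a vector-valued form. -/
def actForm (P : List W → Module.End K W) (β : List W → W) (l : List W) : W :=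
  shuffleSum K l (fun a b => P a (β b))

/-- The identity of `W` as a vector-valued one-form. -/
def idForm : List W → W
  | [w] => w
  | _ => 0

/-- Associativity of the product of forms. -/
theorem actForm_assoc (P Q : List W → Module.End K W) (β : List W → W) (l : List W) :
    actForm P (actForm Q β) l =
      shuffleSum K l (fun d c => shuffleSum K d (fun a b => P a (Q b (β c)))) := by
  unfold actForm
  simp only [map_shuffleSum]
  exact shuffleSum_assoc l fun a b c => P a (Q b (β c))

theorem insertForm_idForm (α : List W → W) (l : List W) : insertForm K α idForm l = α l := by
  unfold insertForm
  rw [← shuffleSum_eq_nil (K := K) l α]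
  refine shuffleSum_congr fun a b _ => ?_
  cases b <;> simp [idForm]

/-- A form that is linear in its first argument and changes its sign if the first two arguments
are exchanged. -/
structure IsSkewForm (K : Type*) {W N : Type*} [CommRing K] [AddCommGroup W] [Module K W]
    [AddCommGroup N] [Module K N] (F : List W → N) : Prop where
  map_add : ∀ u v l, F ((u + v) :: l) = F (u :: l) + F (v :: l)
  map_smul : ∀ (c : K) u l, F ((c • u) :: l) = c • F (u :: l)
  swap : ∀ u v l, F (u :: v :: l) = -F (v :: u :: l)

theorem IsSkewForm.map_zero {F : List W → N} (hF : IsSkewForm K F) (l : List W) :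
    F (0 :: l) = 0 := by
  simpa using hF.map_smul 0 0 l

theorem IsSkewForm.map_shuffleSum {F : List W → N} (hF : IsSkewForm K F) (d c : List W)
    (Φ : List W → List W → W) :
    F (shuffleSum K d Φ :: c) = shuffleSum K d (fun a b => F (Φ a b :: c)) :=
  PreLieDer.map_shuffleSum
    ({ toFun := fun u => F (u :: c)
       map_add' := fun u v => hF.map_add u v c
       map_smul' := fun r u => hF.map_smul r u c } : W →ₗ[K] N) d Φ

theorem IsSkewForm.eval {P : List W → Module.End K W} (hP : IsSkewForm K P) (y : W) :
    IsSkewForm K (fun l => P l y) where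
  map_add u v l := by rw [hP.map_add, LinearMap.add_apply]
  map_smul c u l := by rw [hP.map_smul, LinearMap.smul_apply]
  swap u v l := by rw [hP.swap, LinearMap.neg_apply]

theorem insertForm_apply (α : List W → W) (P : List W → Module.End K W) (l : List W) (y : W) :
    insertForm K α P l y = insertForm K α (fun l => P l y) l :=
  map_shuffleSum (LinearMap.applyₗ y) l _

/-- The insertion of a form of degree `a + 1` is a derivation of degree `a` of the product. -/
theorem insertForm_actForm {p a : ℕ} {P : List W → Module.End K W} (hP : IsConcentrated p P)
    {α : List W → W} (hα : IsConcentrated (a + 1) α) {β : List W → W} (hβ : ∀ l, β (0 :: l) = 0)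
    (l : List W) :
    insertForm K α (actForm P β) l =
      actForm (insertForm K α P) β l + (-1 : K) ^ (p * a) • actForm P (insertForm K α β) l := by
  unfold insertForm actForm
  simp only [shuffleSum_cons, shuffleSum_add]
  congr 1
  · rw [shuffleSum_assoc l fun a b c => P (α a :: b) (β c)]
    refine shuffleSum_congr fun d c _ => ?_
    exact (map_shuffleSum (LinearMap.applyₗ (β c)) d _).symm
  · rw [shuffleSum_assoc l fun a b c => (-1 : K) ^ b.length • P b (β (α a :: c))]
    simp only [map_shuffleSum]
    rw [shuffleSum_assoc l fun a b c => P a (β (α b :: c)), ← shuffleSum_smul]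
    refine shuffleSum_congr fun d c _ => ?_
    rw [shuffleSum_comm, ← shuffleSum_smul]
    refine shuffleSum_congr fun b e _ => ?_
    by_cases hb : b.length = p
    · by_cases he : e.length = a + 1
      · rw [smul_smul, ← pow_add, hb, he, show p * (a + 1) + p = p * a + 2 * p by ring, pow_add,
          pow_mul (-1 : K) 2]
        simp
      · rw [hα e he, hβ]; simp
    · rw [hP b hb]; simp

/-- The simultaneous insertion of two vector-valued forms `α` and `β` into the first two arguments
of a form. -/
def insertPair (K : Type*) {W N : Type*} [CommRing K] [AddCommGroup N] [Module K N]
    (α β : List W → W) (F : List W → N) (l : List W) : N :=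
  shuffleSum K l (fun a c => shuffleSum K c
    (fun b e => (-1 : K) ^ b.length • F (β b :: α a :: e)))

/-- Two successive insertions: the second form goes either into the first one or next to it. -/
theorem insertForm_insertForm (α β : List W → W) {F : List W → N} (hF : IsSkewForm K F)
    (l : List W) :
    insertForm K α (insertForm K β F) l =
      insertForm K (insertForm K α β) F l + insertPair K α β F l := by
  unfold insertForm insertPair
  simp only [shuffleSum_cons, shuffleSum_add, hF.map_shuffleSum]
  rw [shuffleSum_assoc l fun a b c => F (β (α a :: b) :: c)]

/-- Graded symmetry of the simultaneous insertion. -/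
theorem insertPair_comm {a b : ℕ} {α β : List W → W} (hα : IsConcentrated (a + 1) α)
    (hβ : IsConcentrated (b + 1) β) {F : List W → N} (hF : IsSkewForm K F) (l : List W) :
    insertPair K α β F l = (-1 : K) ^ (a * b) • insertPair K β α F l := by
  unfold insertPair
  rw [shuffleSum_assoc l fun a b e => (-1 : K) ^ b.length • F (β b :: α a :: e),
    shuffleSum_assoc l fun a b e => (-1 : K) ^ b.length • F (α b :: β a :: e), ← shuffleSum_smul]
  refine shuffleSum_congr fun d e _ => ?_
  rw [shuffleSum_comm, ← shuffleSum_smul]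
  refine shuffleSum_congr fun u v _ => ?_
  by_cases hu : u.length = b + 1
  · by_cases hv : v.length = a + 1
    · rw [hF.swap (β u), hu, hv, ← neg_one_smul K (F _), smul_smul, smul_smul, smul_smul,
        mul_assoc, ← pow_succ, ← pow_add, ← pow_add,
        show (b + 1) * (a + 1) + (b + 1 + 1) = a * b + (a + 1) + 2 * (b + 1) by ring,
        pow_add _ _ (2 * (b + 1)), pow_mul (-1 : K) 2]
      simp
    · rw [hα v hv, hF.swap (β u), hF.map_zero]; simp
  · rw [hβ u hu, hF.swap (α v), hF.map_zero]; simp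

/-- The vector-valued form `(x_1, …, x_{q+1}) ↦ ∑ ± Q(…, x_{i-1}, x_{i+1}, …; x_i)`, which is
inserted into the alternating arguments of a cochain when it is composed with `Q`. -/
def vectorForm (Q : List W → Module.End K W) : List W → W := actForm Q idForm

theorem IsConcentrated.vectorForm {q : ℕ} {Q : List W → Module.End K W}
    (hQ : IsConcentrated q Q) : IsConcentrated (q + 1) (vectorForm Q) := by
  intro l hl
  unfold PreLieDer.vectorForm actForm
  rw [← shuffleSum_zero (K := K) l]
  refine shuffleSum_congr fun a b hab => ?_
  by_cases ha : a.length = q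
  · match b, hab with
    | [], _ => simp [idForm]
    | [u], h => simp only [List.length_singleton] at h; omega
    | _ :: _ :: _, _ => simp [idForm]
  · rw [hQ a ha, LinearMap.zero_apply]

/-- The product of endomorphism-valued forms. -/
def mulForm (P Q : List W → Module.End K W) (l : List W) : Module.End K W :=
  shuffleSum K l (fun a b => P a ∘ₗ Q b)

theorem mulForm_apply (P Q : List W → Module.End K W) (l : List W) (y : W) :
    mulForm P Q l y = actForm P (fun b => Q b y) l :=
  map_shuffleSum (LinearMap.applyₗ y) l _

theorem actForm_mulForm (P Q : List W → Module.End K W) (β : List W → W) (l : List W) :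
    actForm (mulForm P Q) β l = actForm P (actForm Q β) l := by
  rw [actForm_assoc]
  exact shuffleSum_congr fun d c _ => map_shuffleSum (LinearMap.applyₗ (β c)) d _

/-- The composition of endomorphism-valued forms of degrees `p` and `q`. -/
def compForm (p q : ℕ) (P Q : List W → Module.End K W) (l : List W) : Module.End K W :=
  insertForm K (vectorForm Q) P l + (-1 : K) ^ (p * q) • mulForm P Q l

theorem compForm_apply (p q : ℕ) (P Q : List W → Module.End K W) (l : List W) (y : W) :
    compForm p q P Q l y = insertForm K (vectorForm Q) (fun l => P l y) l +
      (-1 : K) ^ (p * q) • actForm P (fun b => Q b y) l := by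
  rw [compForm, LinearMap.add_apply, LinearMap.smul_apply, insertForm_apply, mulForm_apply]

theorem actForm_add_smul (c : K) (P P' : List W → Module.End K W) (β : List W → W)
    (l : List W) :
    actForm (fun l => P l + c • P' l) β l = actForm P β l + c • actForm P' β l := by
  simp only [actForm, LinearMap.add_apply, LinearMap.smul_apply, shuffleSum_add, shuffleSum_smul]

theorem actForm_add_smul_right (c : K) (P : List W → Module.End K W) (β β' : List W → W)
    (l : List W) :
    actForm P (fun l => β l + c • β' l) l = actForm P β l + c • actForm P β' l := by
  simp only [actForm, map_add, map_smul, shuffleSum_add, shuffleSum_smul]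

theorem idForm_zero_cons (l : List W) : idForm ((0 : W) :: l) = 0 := by
  cases l <;> rfl

theorem insertForm_vectorForm {q r : ℕ} {Q R : List W → Module.End K W}
    (hQ : IsConcentrated q Q) (hR : IsConcentrated r R) :
    insertForm K (vectorForm R) (vectorForm Q) = vectorForm (compForm q r Q R) := by
  funext l
  have e : compForm q r Q R = fun l =>
      insertForm K (vectorForm R) Q l + (-1 : K) ^ (q * r) • mulForm Q R l := rfl
  have h := insertForm_actForm (K := K) hQ hR.vectorForm idForm_zero_cons l
  rw [funext (insertForm_idForm (K := K) (vectorForm R))] at h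
  change _ = actForm (compForm q r Q R) idForm l
  rw [e, actForm_add_smul, actForm_mulForm]
  exact h

/-- The associator of the composition. -/
theorem compForm_assoc {p q r : ℕ} {P Q R : List W → Module.End K W} (hP : IsConcentrated p P)
    (hQ : IsConcentrated q Q) (hR : IsConcentrated r R) (sP : IsSkewForm K P)
    (sQ : IsSkewForm K Q) (l : List W) (y : W) :
    compForm (p + q) r (compForm p q P Q) R l y - compForm p (q + r) P (compForm q r Q R) l y =
      insertPair K (vectorForm R) (vectorForm Q) (fun l => P l y) l +
      ((-1 : K) ^ (p * q) • actForm (insertForm K (vectorForm R) P) (fun b => Q b y) l +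
      (-1 : K) ^ ((p + q) * r) • actForm (insertForm K (vectorForm Q) P) (fun b => R b y) l) := by
  have e : compForm p q P Q = fun l =>
      insertForm K (vectorForm Q) P l + (-1 : K) ^ (p * q) • mulForm P Q l := rfl
  rw [compForm_apply, compForm_apply, ← insertForm_vectorForm hQ hR]
  simp only [compForm_apply p q P Q, compForm_apply q r Q R]
  rw [e, actForm_add_smul, actForm_mulForm, actForm_add_smul_right, insertForm_add_smul,
    insertForm_actForm hP hR.vectorForm (sQ.eval y).map_zero,
    insertForm_insertForm _ _ (sP.eval y)]
  simp only [smul_add, smul_smul, mul_add, pow_add, add_mul]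
  module

/-- The composition of forms is a graded right pre-Lie product. -/
theorem compForm_preLie {p q r : ℕ} {P Q R : List W → Module.End K W} (hP : IsConcentrated p P)
    (hQ : IsConcentrated q Q) (hR : IsConcentrated r R) (sP : IsSkewForm K P)
    (sQ : IsSkewForm K Q) (sR : IsSkewForm K R) (l : List W) (y : W) :
    compForm (p + q) r (compForm p q P Q) R l y - compForm p (q + r) P (compForm q r Q R) l y =
      (-1 : K) ^ (q * r) • (compForm (p + r) q (compForm p r P R) Q l y -
        compForm p (r + q) P (compForm r q R Q) l y) := by
  rw [compForm_assoc hP hQ hR sP sQ, compForm_assoc hP hR hQ sP sR,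
    insertPair_comm hR.vectorForm hQ.vectorForm (sP.eval y)]
  have h : (-1 : K) ^ (q * r) * (-1 : K) ^ (q * r) = 1 := by rw [← mul_pow]; simp
  simp only [smul_add, smul_smul, add_mul, pow_add, mul_comm r q, mul_comm _ ((-1 : K) ^ (q * r)),
    ← mul_assoc, h, one_mul]
  abel

end Forms

/-! ### Sums over unshuffles as sums over splittings -/

section UnshuffleRecursion

/-- The permutation that sends `i` to `0` and whose values at the other positions are given, in
order, by `τ`. -/
def insertZero {n : ℕ} (i : Fin (n + 1)) (τ : Equiv.Perm (Fin n)) : Equiv.Perm (Fin (n + 1)) :=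
  Equiv.Perm.decomposeFin.symm (0, τ) * i.cycleRange

theorem insertZero_self {n : ℕ} (i : Fin (n + 1)) (τ : Equiv.Perm (Fin n)) :
    insertZero i τ i = 0 := by
  simp [insertZero]

theorem insertZero_succAbove {n : ℕ} (i : Fin (n + 1)) (τ : Equiv.Perm (Fin n)) (k : Fin n) :
    insertZero i τ (i.succAbove k) = (τ k).succ := by
  simp [insertZero, Fin.cycleRange_succAbove]

theorem sign_insertZero {n : ℕ} (i : Fin (n + 1)) (τ : Equiv.Perm (Fin n)) :
    Equiv.Perm.sign (insertZero i τ) = (-1) ^ (i : ℕ) * Equiv.Perm.sign τ := by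
  simp [insertZero, Equiv.Perm.decomposeFin.symm_sign, mul_comm]

theorem insertZero_bijective (n : ℕ) :
    Function.Bijective (fun z : Fin (n + 1) × Equiv.Perm (Fin n) => insertZero z.1 z.2) := by
  rw [Fintype.bijective_iff_injective_and_card]
  constructor
  · rintro ⟨i, τ⟩ ⟨i', τ'⟩ h
    have h : insertZero i τ = insertZero i' τ' := h
    obtain rfl : i = i' := by
      apply (insertZero i τ).injective
      rw [insertZero_self, h, insertZero_self]
    refine Prod.ext rfl (Equiv.ext fun k => ?_)
    have := insertZero_succAbove i τ k
    rw [h, insertZero_succAbove] at this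
    exact (Fin.succ_injective _ this).symm
  · simp [Fintype.card_perm, Nat.factorial_succ]

/-- In an unshuffle, the smallest value can only be taken at the first position of a block. -/
theorem isUnshuffle_insertZero {n : ℕ} (b : Fin (n + 1) → ℕ) (i : Fin (n + 1))
    (τ : Equiv.Perm (Fin n)) :
    IsUnshuffle b (insertZero i τ) ↔
      (∀ j, j < i → b j ≠ b i) ∧ IsUnshuffle (b ∘ i.succAbove) τ := by
  constructor
  · intro h
    refine ⟨fun j hj hb => ?_, fun k m hkm hb => ?_⟩
    · have := h j i hj hb
      rw [insertZero_self] at this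
      exact absurd this (Fin.not_lt_zero _)
    · have := h (i.succAbove k) (i.succAbove m) (Fin.succAbove_lt_succAbove_iff.2 hkm) hb
      rwa [insertZero_succAbove, insertZero_succAbove, Fin.succ_lt_succ_iff] at this
  · rintro ⟨h1, h2⟩ a c hac hb
    rcases Fin.eq_self_or_eq_succAbove i c with rfl | ⟨m, rfl⟩
    · exact absurd hb (h1 a hac)
    · rcases Fin.eq_self_or_eq_succAbove i a with rfl | ⟨k, rfl⟩
      · rw [insertZero_self, insertZero_succAbove]
        exact Fin.succ_pos _
      · rw [insertZero_succAbove, insertZero_succAbove, Fin.succ_lt_succ_iff]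
        exact h2 k m (Fin.succAbove_lt_succAbove_iff.1 hac) hb

theorem ofFn_insertNth {W : Type*} {n : ℕ} (i : Fin (n + 1)) (w : W) (z : Fin n → W) :
    List.ofFn (i.insertNth w z : Fin (n + 1) → W) =
      (List.ofFn z).take i ++ w :: (List.ofFn z).drop i := by
  induction n with
  | zero =>
    obtain rfl : i = 0 := Fin.fin_one_eq_zero i
    simp
  | succ n ih =>
    refine Fin.cases ?_ (fun i => ?_) i
    · simp
    · have e : (i.succ.insertNth w z : Fin (n + 2) → W) =
          Fin.cons (z 0) (i.insertNth w (Fin.tail z) : Fin (n + 1) → W) := by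
        conv_lhs => rw [← Fin.cons_self_tail z]
        exact Fin.insertNth_succ_cons ..
      rw [e, List.ofFn_cons, ih, List.ofFn_succ (f := z)]
      simp
      rfl

variable {W N : Type*} [AddCommGroup N]

/-- The signed sum over all unshuffles with blocks `b` of a function of the list of the permuted
arguments. -/
def permSum {n : ℕ} (b : Fin n → ℕ) (Φ : List W → N) (x : Fin n → W) : N :=
  ∑ σ : Equiv.Perm (Fin n) with IsUnshuffle b σ,
    Equiv.Perm.sign σ • Φ (List.ofFn fun k => x (σ k))

/-- The first argument has to be the first one in its block. -/
theorem permSum_cons {n : ℕ} (b : Fin (n + 1) → ℕ) (Φ : List W → N) (w : W) (x : Fin n → W) :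
    permSum b Φ (Fin.cons w x) = ∑ i : Fin (n + 1) with ∀ j, j < i → b j ≠ b i,
      (-1 : ℤˣ) ^ (i : ℕ) •
        permSum (b ∘ i.succAbove) (fun l => Φ (l.take i ++ w :: l.drop i)) x := by
  unfold permSum
  rw [Finset.sum_filter, ← (insertZero_bijective n).sum_comp, Fintype.sum_prod_type,
    Finset.sum_filter]
  refine Finset.sum_congr rfl fun i _ => ?_
  rw [Finset.sum_filter, Finset.smul_sum]
  split_ifs with h
  · refine Finset.sum_congr rfl fun τ _ => ?_
    simp only [isUnshuffle_insertZero, and_iff_right h, sign_insertZero]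
    split_ifs
    · rw [mul_smul, ← ofFn_insertNth]
      congr 4
      funext k
      rcases Fin.eq_self_or_eq_succAbove i k with rfl | ⟨m, rfl⟩
      · simp [insertZero_self]
      · simp [insertZero_succAbove]
    · rw [smul_zero]
  · refine Finset.sum_eq_zero fun τ _ => ?_
    simp only [isUnshuffle_insertZero, h, false_and, if_false]

theorem permSum_congr {n : ℕ} {b b' : Fin n → ℕ} (hb : ∀ i j, b i = b j ↔ b' i = b' j)
    {Φ Φ' : List W → N} (h : ∀ l : List W, l.length = n → Φ l = Φ' l) (x : Fin n → W) :
    permSum b Φ x = permSum b' Φ' x := by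
  unfold permSum
  refine Finset.sum_congr (Finset.filter_congr fun σ _ => ?_) fun σ _ => ?_
  · simp only [IsUnshuffle, hb]
  · rw [h _ (List.length_ofFn)]

variable {K : Type*} [CommRing K] [Module K N]

theorem neg_one_pow_units_smul (i : ℕ) (x : N) : (-1 : ℤˣ) ^ i • x = (-1 : K) ^ i • x := by
  rcases Nat.even_or_odd i with h | h <;> simp [h.neg_one_pow]

theorem sum_dite_val_eq {n : ℕ} (f : Fin n → N) (p : ℕ) :
    ∑ i : Fin n, (if (i : ℕ) = p then f i else 0) = if h : p < n then f ⟨p, h⟩ else 0 := by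
  split_ifs with h
  · rw [Finset.sum_eq_single ⟨p, h⟩]
    · simp
    · intro i _ hi
      rw [if_neg fun h => hi (Fin.ext h)]
    · simp
  · refine Finset.sum_eq_zero fun i _ => ?_
    rw [if_neg]
    have := i.isLt
    omega

theorem sum_first_blocksTwo {n : ℕ} (p : ℕ) (f : Fin (n + 1) → N) :
    ∑ i : Fin (n + 1) with ∀ j, j < i → blocksTwo p (n + 1) j ≠ blocksTwo p (n + 1) i, f i =
      (if 0 < p then f 0 else 0) + if h : p < n + 1 then f ⟨p, h⟩ else 0 := by
  have h0 : (if 0 < p then f 0 else 0) =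
      ∑ i : Fin (n + 1), (if (i : ℕ) = 0 then (if 0 < p then f i else 0) else 0) := by
    rw [sum_dite_val_eq, dif_pos (Nat.succ_pos n)]
    rfl
  rw [h0, ← sum_dite_val_eq, ← Finset.sum_add_distrib, Finset.sum_filter]
  refine Finset.sum_congr rfl fun i _ => ?_
  have key : (∀ j, j < i → blocksTwo p (n + 1) j ≠ blocksTwo p (n + 1) i) ↔
      ((i : ℕ) = 0 ∧ 0 < p) ∨ (i : ℕ) = p := by
    have hi := i.isLt
    unfold blocksTwo
    constructor
    · intro h
      by_contra hc
      rcases lt_or_ge (i : ℕ) p with hp | hp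
      · have := h ⟨0, by omega⟩ (Fin.lt_def.2 (by simp only []; omega))
        simp only [] at this
        split_ifs at this <;> omega
      · have := h ⟨p, by omega⟩ (Fin.lt_def.2 (by simp only []; omega))
        simp only [] at this
        split_ifs at this <;> omega
    · intro h j hj
      have : (j : ℕ) < i := hj
      split_ifs <;> omega
  simp only [key]
  by_cases h1 : (i : ℕ) = 0 <;> by_cases h2 : 0 < p <;> by_cases h3 : (i : ℕ) = p <;>
    simp only [h1, h2, h3] <;> simp <;> omega

theorem sum_first_blocksThree {n : ℕ} (q : ℕ) (f : Fin (n + 1) → N) :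
    ∑ i : Fin (n + 1) with ∀ j, j < i → blocksThree q (n + 1) j ≠ blocksThree q (n + 1) i, f i =
      (if 0 < q then f 0 else 0) + ((if h : q < n + 1 then f ⟨q, h⟩ else 0) +
        if h : q + 1 < n + 1 then f ⟨q + 1, h⟩ else 0) := by
  have h0 : (if 0 < q then f 0 else 0) =
      ∑ i : Fin (n + 1), (if (i : ℕ) = 0 then (if 0 < q then f i else 0) else 0) := by
    rw [sum_dite_val_eq, dif_pos (Nat.succ_pos n)]
    rfl
  rw [h0, ← sum_dite_val_eq, ← sum_dite_val_eq, ← Finset.sum_add_distrib,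
    ← Finset.sum_add_distrib, Finset.sum_filter]
  refine Finset.sum_congr rfl fun i _ => ?_
  have key : (∀ j, j < i → blocksThree q (n + 1) j ≠ blocksThree q (n + 1) i) ↔
      ((i : ℕ) = 0 ∧ 0 < q) ∨ (i : ℕ) = q ∨ (i : ℕ) = q + 1 := by
    have hi := i.isLt
    unfold blocksThree
    constructor
    · intro h
      by_contra hc
      rcases lt_or_ge (i : ℕ) q with hp | hp
      · have := h ⟨0, by omega⟩ (Fin.lt_def.2 (by simp only []; omega))
        simp only [] at this
        split_ifs at this <;> omega
      · have := h ⟨q + 1, by omega⟩ (Fin.lt_def.2 (by simp only []; omega))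
        simp only [] at this
        split_ifs at this <;> omega
    · intro h j hj
      have : (j : ℕ) < i := hj
      split_ifs <;> omega
  simp only [key]
  by_cases h1 : (i : ℕ) = 0 <;> by_cases h2 : 0 < q <;> by_cases h3 : (i : ℕ) = q <;>
    by_cases h4 : (i : ℕ) = q + 1 <;> simp only [h1, h2, h3, h4] <;> simp <;> omega

theorem permSum_fin_zero (b : Fin 0 → ℕ) (Φ : List W → N) (x : Fin 0 → W) :
    permSum b Φ x = Φ [] := by
  unfold permSum
  rw [Finset.sum_filter, Fintype.sum_subsingleton _ 1,
    if_pos (show IsUnshuffle b 1 from fun i => i.elim0)]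
  simp

/-- The sum over all `(p, n - p)`-unshuffles in terms of sublists. -/
theorem permSum_blocksTwo {n : ℕ} (p : ℕ) (hp : p ≤ n) (Ψ : List W → List W → N) (x : Fin n → W) :
    permSum (blocksTwo p n) (fun l => Ψ (l.take p) (l.drop p)) x =
      shuffleSum K (List.ofFn x) (fun a b => if a.length = p then Ψ a b else 0) := by
  induction n generalizing p Ψ with
  | zero =>
    obtain rfl : p = 0 := by omega
    simp [permSum_fin_zero, shuffleSum_nil]
  | succ n ih =>
    obtain ⟨w, x, rfl⟩ : ∃ w x', x = Fin.cons w x' := ⟨x 0, _, (Fin.cons_self_tail x).symm⟩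
    rw [permSum_cons, sum_first_blocksTwo, List.ofFn_cons, shuffleSum_cons]
    congr 1
    · rcases p with _ | p
      · simp [shuffleSum_zero]
      · simp only [Nat.succ_pos, if_true, Fin.val_zero, pow_zero, one_smul, List.length_cons,
          Nat.add_right_cancel_iff]
        rw [← ih p (by omega) fun a b => Ψ (w :: a) b]
        exact permSum_congr (fun i j => by simp [blocksTwo]) (fun l _ => by simp) _
    · split_ifs with h
      · have e : shuffleSum K (List.ofFn x)
            (fun a b => (-1 : K) ^ a.length • if a.length = p then Ψ a (w :: b) else 0) =
            (-1 : K) ^ p • shuffleSum K (List.ofFn x)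
              (fun a b => if a.length = p then Ψ a (w :: b) else 0) := by
          rw [← shuffleSum_smul]
          refine shuffleSum_congr fun a b _ => ?_
          split_ifs with ha
          · rw [ha]
          · rw [smul_zero, smul_zero]
        rw [e, ← ih p (by omega) fun a b => Ψ a (w :: b), neg_one_pow_units_smul (K := K)]
        congr 1
        refine permSum_congr (fun i j => ?_) (fun l hl => ?_) _
        · have e (i : Fin n) : blocksTwo p (n + 1) ((⟨p, h⟩ : Fin (n + 1)).succAbove i) =
              blocksTwo p n i := by
            unfold blocksTwo Fin.succAbove
            simp only [Fin.lt_def, Fin.val_castSucc]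
            split_ifs <;> simp_all <;> omega
          simp [e]
        · have : p ≤ l.length := by omega
          simp [this]
      · refine ((shuffleSum_congr fun a b hab => ?_).trans (shuffleSum_zero (K := K) _)).symm
        rw [List.length_ofFn] at hab
        rw [if_neg (by omega), smul_zero]

/-- The sum over all `(q, 1, n - q - 1)`-unshuffles in terms of sublists. -/
theorem permSum_blocksThree {n : ℕ} (q : ℕ) (hq : q < n) (Θ : List W → List W → N)
    (x : Fin n → W) :
    permSum (blocksThree q n) (fun l => Θ (l.take q) (l.drop q)) x =
      shuffleSum K (List.ofFn x) (fun d c => shuffleSum K d (fun a m =>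
        if a.length = q ∧ m.length = 1 then Θ a (m ++ c) else 0)) := by
  induction n generalizing q Θ with
  | zero => omega
  | succ n ih =>
    obtain ⟨w, x, rfl⟩ : ∃ w x', x = Fin.cons w x' := ⟨x 0, _, (Fin.cons_self_tail x).symm⟩
    rw [permSum_cons, sum_first_blocksThree, List.ofFn_cons, shuffleSum_cons]
    simp only [shuffleSum_cons, shuffleSum_add]
    rw [add_assoc]
    congr 1
    · rcases q with _ | q
      · simp [shuffleSum_zero]
      · simp only [Nat.succ_pos, if_true, Fin.val_zero, pow_zero, one_smul, List.length_cons,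
          Nat.add_right_cancel_iff]
        rw [← ih q (by omega) fun a b => Θ (w :: a) b]
        exact permSum_congr (fun i j => by simp [blocksThree]) (fun l _ => by simp) _
    congr 1
    -- The first argument is the entry of the middle block: two blocks remain.
    · have e : shuffleSum K (List.ofFn x) (fun d c => shuffleSum K d (fun a m =>
            (-1 : K) ^ a.length • if a.length = q ∧ (w :: m).length = 1 then
              Θ a (w :: m ++ c) else 0)) =
          (-1 : K) ^ q • shuffleSum K (List.ofFn x)
            (fun d c => if d.length = q then Θ d (w :: c) else 0) := by
        rw [← shuffleSum_smul]
        refine shuffleSum_congr fun d c _ => ?_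
        rw [← shuffleSum_eq_nil (K := K) d (fun a => if a.length = q then Θ a (w :: c) else 0),
          ← shuffleSum_smul]
        refine shuffleSum_congr fun a m _ => ?_
        rcases m with _ | ⟨u, m⟩
        · by_cases ha : a.length = q <;> simp [ha]
        · simp
      rw [e, dif_pos hq, ← permSum_blocksTwo q (by omega) fun a b => Θ a (w :: b),
        neg_one_pow_units_smul (K := K)]
      congr 1
      refine permSum_congr (fun i j => ?_) (fun l hl => ?_) _
      · have e (i : Fin n) : blocksThree q (n + 1) ((⟨q, hq⟩ : Fin (n + 1)).succAbove i) =
            2 * blocksTwo q n i := by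
          unfold blocksTwo blocksThree Fin.succAbove
          simp only [Fin.lt_def, Fin.val_castSucc]
          split_ifs <;> simp_all <;> omega
        simp [e]
      · have : q ≤ l.length := by omega
        simp [this]
    · have e : shuffleSum K (List.ofFn x) (fun d c => (-1 : K) ^ d.length •
            shuffleSum K d (fun a m => if a.length = q ∧ m.length = 1 then
              Θ a (m ++ w :: c) else 0)) =
          (-1 : K) ^ (q + 1) • shuffleSum K (List.ofFn x) (fun d c => shuffleSum K d (fun a m =>
            if a.length = q ∧ m.length = 1 then
              Θ a ((m ++ c).take 1 ++ w :: (m ++ c).drop 1) else 0)) := by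
        rw [← shuffleSum_smul]
        refine shuffleSum_congr fun d c _ => ?_
        rw [← shuffleSum_smul, ← shuffleSum_smul]
        refine shuffleSum_congr fun a m ham => ?_
        split_ifs with h
        · rw [← ham, h.1, h.2, List.take_left' h.2, List.drop_left' h.2]
        · simp
      split_ifs with h
      · rw [e, ← ih q (by omega) fun a b => Θ a (b.take 1 ++ w :: b.drop 1),
          neg_one_pow_units_smul (K := K)]
        congr 1
        refine permSum_congr (fun i j => ?_) (fun l hl => ?_) _
        · have e (i : Fin n) : blocksThree q (n + 1) ((⟨q + 1, h⟩ : Fin (n + 1)).succAbove i) =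
              blocksThree q n i := by
            unfold blocksThree Fin.succAbove
            simp only [Fin.lt_def, Fin.val_castSucc]
            split_ifs <;> simp_all <;> omega
          simp [e]
        · have h1 : q + 1 ≤ l.length := by omega
          congr 1
          · rw [List.take_append_of_le_length (by simp; omega), List.take_take]
            simp
          · rw [List.drop_append_of_le_length (by simp; omega), List.drop_take, List.drop_drop]
            simp
      · refine (((shuffleSum_congr fun d c hdc => ?_).trans (shuffleSum_zero (K := K) _))).symm
        refine (congrArg _ ((shuffleSum_congr fun a m ham => ?_).trans
          (shuffleSum_zero (K := K) _))).trans (smul_zero _)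
        rw [List.length_ofFn] at hdc
        rw [if_neg (by omega)]

end UnshuffleRecursion

/-! ### Cochains as forms and the graded Jacobi identity -/

section CochainForms

variable {K W : Type*} [CommRing K] [AddCommGroup W] [Module K W]

/-- The function on lists defined by an element of the space of all cochains: the component with
`p` alternating arguments is evaluated on lists of length `p`. -/
def toForm (f : CochainSpace K W) (l : List W) : Module.End K W := f l.length l.get

theorem toForm_eq (f : CochainSpace K W) {l : List W} {n : ℕ} (h : l.length = n) :
    toForm f l = f n fun k => l.get (k.cast h.symm) := by
  subst h
  rfl

theorem toForm_ofFn (f : CochainSpace K W) {n : ℕ} (x : Fin n → W) :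
    toForm f (List.ofFn x) = f n x := by
  rw [toForm_eq f (List.length_ofFn (f := x))]
  congr 1
  funext k
  simp

theorem cochainSpace_ext {f f' : CochainSpace K W} (h : ∀ l y, toForm f l y = toForm f' l y) :
    f = f' := by
  refine DirectSum.ext_component K fun n => Cochain.ext fun x y => ?_
  have := h (List.ofFn x) y
  rwa [toForm_ofFn, toForm_ofFn] at this

theorem toForm_sub (f f' : CochainSpace K W) (l : List W) :
    toForm (f - f') l = toForm f l - toForm f' l := rfl

theorem toForm_smul (c : K) (f : CochainSpace K W) (l : List W) :
    toForm (c • f) l = c • toForm f l := rfl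

theorem toForm_lof {p : ℕ} (P : Cochain K W p) (x : Fin p → W) :
    toForm (DirectSum.lof K ℕ (Cochain K W) p P) (List.ofFn x) = P x := by
  rw [toForm_ofFn, DirectSum.lof_apply]

theorem isConcentrated_toForm_lof {p : ℕ} (P : Cochain K W p) :
    IsConcentrated p (toForm (DirectSum.lof K ℕ (Cochain K W) p P)) := by
  intro l hl
  rw [toForm, DirectSum.lof_eq_of, DirectSum.of_eq_of_ne _ _ _ hl]
  rfl

theorem toForm_cons (f : CochainSpace K W) (u : W) (l : List W) :
    toForm f (u :: l) = f (l.length + 1) (Matrix.vecCons u l.get) := by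
  rw [toForm]
  congr 1
  funext k
  refine Fin.cases ?_ (fun k => ?_) k <;> rfl

theorem isSkewForm_toForm (f : CochainSpace K W) : IsSkewForm K (toForm f) where
  map_add u v l := by
    simp only [toForm_cons]
    exact AlternatingMap.map_vecCons_add (f (l.length + 1)) l.get u v
  map_smul c u l := by
    simp only [toForm_cons]
    exact AlternatingMap.map_vecCons_smul (f (l.length + 1)) l.get c u
  swap u v l := by
    rw [toForm, toForm]
    have h := AlternatingMap.map_swap (f (l.length + 2)) (v :: u :: l).get
      (i := (0 : Fin (l.length + 2))) (j := 1) (by simp)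
    refine Eq.trans (congrArg _ ?_) h
    funext k
    refine Fin.cases ?_ (fun k => Fin.cases ?_ (fun k => ?_) k) k
    · simp
    · simp
    · rw [Function.comp_apply, Equiv.swap_apply_of_ne_of_ne (by simp [Fin.ext_iff])
        (by simp [Fin.ext_iff])]
      rfl

theorem circLast_eq_actForm {p q : ℕ} (P : Cochain K W p) (Q : Cochain K W q)
    (x : Fin (p + q) → W) (y : W) :
    circLast P Q x y = actForm (toForm (DirectSum.lof K ℕ (Cochain K W) p P))
      (fun b => toForm (DirectSum.lof K ℕ (Cochain K W) q Q) b y) (List.ofFn x) := by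
  set P' := toForm (DirectSum.lof K ℕ (Cochain K W) p P)
  set Q' := toForm (DirectSum.lof K ℕ (Cochain K W) q Q)
  have h := permSum_blocksTwo (K := K) p (Nat.le_add_right p q) (fun a b => P' a (Q' b y)) x
  rw [circLast_apply]
  refine (Eq.trans ?_ h).trans ?_
  · unfold permSum
    refine Finset.sum_congr rfl fun σ _ => ?_
    congr 1
    have e1 : (List.ofFn fun k => x (σ k)).take p =
        List.ofFn fun k : Fin p => x (σ ⟨k, by omega⟩) :=
      List.ext_getElem (by simp) (by simp)
    have e2 : (List.ofFn fun k => x (σ k)).drop p =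
        List.ofFn fun k : Fin q => x (σ ⟨p + k, by omega⟩) :=
      List.ext_getElem (by simp) (by simp)
    simp only [e1, e2, P', Q', toForm_lof]
  · refine shuffleSum_congr fun a b _ => ?_
    split_ifs with ha
    · rfl
    · have h0 : P' a = 0 := isConcentrated_toForm_lof P a ha
      rw [h0, LinearMap.zero_apply]

theorem circFirst_eq_insertForm {p q : ℕ} (P : Cochain K W p) (Q : Cochain K W q)
    (x : Fin (p + q) → W) (y : W) :
    circFirst P Q x y = insertForm K (vectorForm (toForm (DirectSum.lof K ℕ (Cochain K W) q Q)))
      (fun l => toForm (DirectSum.lof K ℕ (Cochain K W) p P) l y) (List.ofFn x) := by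
  rcases p with _ | p
  · refine ((shuffleSum_congr fun a b _ => ?_).trans (shuffleSum_zero (K := K) _)).symm
    exact LinearMap.congr_fun (isConcentrated_toForm_lof P (_ :: b) (by simp)) y
  have hP := isConcentrated_toForm_lof P
  have hQ := isConcentrated_toForm_lof Q
  have sP := (isSkewForm_toForm (DirectSum.lof K ℕ (Cochain K W) (p + 1) P)).eval y
  have hPx (z : Fin (p + 1) → W) := toForm_lof P z
  have hQx (z : Fin q → W) := toForm_lof Q z
  generalize toForm (DirectSum.lof K ℕ (Cochain K W) (p + 1) P) = P' at *
  generalize toForm (DirectSum.lof K ℕ (Cochain K W) q Q) = Q' at *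
  let Θ : List W → List W → W := fun a c => match c with
    | [] => 0
    | u :: b => P' (Q' a u :: b) y
  have h := permSum_blocksThree (K := K) q (by omega) Θ x
  rw [circFirst_succ_apply]
  refine (Eq.trans ?_ h).trans ?_
  · unfold permSum
    refine Finset.sum_congr rfl fun σ _ => ?_
    congr 1
    have e1 : (List.ofFn fun k => x (σ k)).take q =
        List.ofFn fun k : Fin q => x (σ ⟨k, by omega⟩) :=
      List.ext_getElem (by simp) (by simp)
    have e2 : (List.ofFn fun k => x (σ k)).drop q =
        x (σ ⟨q, by omega⟩) :: List.ofFn fun k : Fin p => x (σ ⟨q + 1 + k, by omega⟩) := by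
      refine List.ext_getElem (by simp) fun i h1 h2 => ?_
      rcases i with _ | i
      · simp
      · rw [List.getElem_drop, List.getElem_cons_succ, List.getElem_ofFn, List.getElem_ofFn]
        congr 3
        change q + (i + 1) = q + 1 + i
        omega
    have e3 : P' (Q' (List.ofFn fun k : Fin q => x (σ ⟨k, by omega⟩)) (x (σ ⟨q, by omega⟩)) ::
        List.ofFn fun k : Fin p => x (σ ⟨q + 1 + k, by omega⟩)) = P (Fin.cons
          (Q (fun k : Fin q => x (σ ⟨k, by omega⟩)) (x (σ ⟨q, by omega⟩)))
          (fun k : Fin p => x (σ ⟨q + 1 + k, by omega⟩))) := by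
      rw [hQx, ← List.ofFn_cons, hPx]
    simp only [e1, e2, Θ, e3]
  · refine shuffleSum_congr fun d c _ => ?_
    refine Eq.trans ?_ (sP.map_shuffleSum d c _).symm
    refine shuffleSum_congr fun a m _ => ?_
    match m with
    | [] => simp [idForm, sP.map_zero]
    | [u] =>
      by_cases ha : a.length = q
      · simp [ha, Θ, idForm]
      · simp [ha, hQ a ha, sP.map_zero]
    | _ :: _ :: _ => simp [idForm, sP.map_zero]

theorem IsConcentrated.compForm {p q : ℕ} {P Q : List W → Module.End K W}
    (hP : IsConcentrated p P) (hQ : IsConcentrated q Q) (sP : IsSkewForm K P) :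
    IsConcentrated (p + q) (compForm p q P Q) := by
  intro l hl
  have e1 : insertForm K (PreLieDer.vectorForm Q) P l = 0 := by
    refine (shuffleSum_congr fun a b hab => ?_).trans (shuffleSum_zero (K := K) _)
    by_cases ha : a.length = q + 1
    · exact hP _ (by simp only [List.length_cons]; omega)
    · rw [hQ.vectorForm a ha, sP.map_zero]
  have e2 : mulForm P Q l = 0 := by
    refine (shuffleSum_congr fun a b hab => ?_).trans (shuffleSum_zero (K := K) _)
    by_cases ha : a.length = p
    · rw [hQ b (by omega), LinearMap.comp_zero]
    · rw [hP a ha, LinearMap.zero_comp]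
  rw [PreLieDer.compForm, e1, e2, smul_zero, add_zero]

/-- The composition of cochains is the composition of the corresponding forms. -/
theorem toForm_circ {p q : ℕ} (P : Cochain K W p) (Q : Cochain K W q) :
    toForm (DirectSum.lof K ℕ (Cochain K W) (p + q) (circ p q P Q)) =
      compForm p q (toForm (DirectSum.lof K ℕ (Cochain K W) p P))
        (toForm (DirectSum.lof K ℕ (Cochain K W) q Q)) := by
  funext l
  by_cases hl : l.length = p + q
  · obtain ⟨x, rfl⟩ : ∃ x : Fin (p + q) → W, l = List.ofFn x :=
      ⟨fun k => l.get (k.cast hl.symm), List.ext_getElem (by simp [hl]) (by simp)⟩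
    refine LinearMap.ext fun y => ?_
    rw [toForm_lof, compForm_apply, ← circFirst_eq_insertForm, ← circLast_eq_actForm]
    rfl
  · rw [isConcentrated_toForm_lof _ l hl, (isConcentrated_toForm_lof P).compForm
      (isConcentrated_toForm_lof Q) (isSkewForm_toForm _) l hl]

/-- The composition of cochains is a graded right pre-Lie product. -/
theorem circ_preLie {p q r : ℕ} (P : Cochain K W p) (Q : Cochain K W q) (R : Cochain K W r) :
    DirectSum.lof K ℕ (Cochain K W) (p + q + r) (circ (p + q) r (circ p q P Q) R) -
        DirectSum.lof K ℕ (Cochain K W) (p + (q + r)) (circ p (q + r) P (circ q r Q R)) =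
      (-1 : K) ^ (q * r) •
        (DirectSum.lof K ℕ (Cochain K W) (p + r + q) (circ (p + r) q (circ p r P R) Q) -
          DirectSum.lof K ℕ (Cochain K W) (p + (r + q)) (circ p (r + q) P (circ r q R Q))) := by
  refine cochainSpace_ext fun l y => ?_
  simp only [toForm_sub, toForm_smul, toForm_circ, LinearMap.sub_apply, LinearMap.smul_apply]
  exact compForm_preLie (isConcentrated_toForm_lof P) (isConcentrated_toForm_lof Q)
    (isConcentrated_toForm_lof R) (isSkewForm_toForm _) (isSkewForm_toForm _)
    (isSkewForm_toForm _) l y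

theorem mnBracket_lof_comm {p q : ℕ} (P : Cochain K W p) (Q : Cochain K W q) :
    mnBracket (DirectSum.lof K ℕ (Cochain K W) p P) (DirectSum.lof K ℕ (Cochain K W) q Q) =
      -((-1 : K) ^ (p * q) •
        mnBracket (DirectSum.lof K ℕ (Cochain K W) q Q) (DirectSum.lof K ℕ (Cochain K W) p P)) := by
  rw [mnBracket_lof_lof, mnBracket_lof_lof, mul_comm q p]
  rcases neg_one_pow_eq_or K (p * q) with h | h <;> rw [h] <;> module

/-- The graded Jacobi identity for the Matsushima–Nijenhuis bracket. -/
theorem mnBracket_lof_jacobi {p q r : ℕ} (P : Cochain K W p) (Q : Cochain K W q)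
    (R : Cochain K W r) :
    mnBracket (mnBracket (DirectSum.lof K ℕ (Cochain K W) p P)
        (DirectSum.lof K ℕ (Cochain K W) q Q)) (DirectSum.lof K ℕ (Cochain K W) r R) =
      mnBracket (DirectSum.lof K ℕ (Cochain K W) p P)
        (mnBracket (DirectSum.lof K ℕ (Cochain K W) q Q) (DirectSum.lof K ℕ (Cochain K W) r R)) +
      (-1 : K) ^ (q * r) • mnBracket (mnBracket (DirectSum.lof K ℕ (Cochain K W) p P)
        (DirectSum.lof K ℕ (Cochain K W) r R)) (DirectSum.lof K ℕ (Cochain K W) q Q) := by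
  have h1 := circ_preLie P Q R
  have h2 := circ_preLie Q P R
  have h3 := circ_preLie R P Q
  simp only [mnBracket_lof_lof, map_sub, map_smul, LinearMap.sub_apply, LinearMap.smul_apply]
  have e1 : (-1 : K) ^ ((p + q) * r) = (-1) ^ (p * r) * (-1) ^ (q * r) := by rw [add_mul, pow_add]
  have e2 : (-1 : K) ^ ((q + p) * r) = (-1) ^ (p * r) * (-1) ^ (q * r) := by
    rw [add_mul, pow_add, mul_comm]
  have e3 : (-1 : K) ^ ((p + r) * q) = (-1) ^ (p * q) * (-1) ^ (q * r) := by
    rw [add_mul, pow_add, mul_comm r q]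
  have e4 : (-1 : K) ^ ((r + p) * q) = (-1) ^ (p * q) * (-1) ^ (q * r) := by
    rw [add_comm, e3]
  have e5 : (-1 : K) ^ (p * (q + r)) = (-1) ^ (p * q) * (-1) ^ (p * r) := by rw [mul_add, pow_add]
  have e6 : (-1 : K) ^ (p * (r + q)) = (-1) ^ (p * q) * (-1) ^ (p * r) := by
    rw [add_comm, e5]
  -- The Jacobi identity is a combination of the three pre-Lie identities in which `P`, `Q` or `R`
  -- comes first. The coefficients are the signs of moving `Q` or `R` to the front, times the
  -- Koszul signs.
  have h2' := congrArg (fun z => (-1 : K) ^ (p * q) • z) h2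
  have h3' := congrArg (fun z => ((-1 : K) ^ (p * r) * (-1 : K) ^ (q * r)) • z) h3
  simp only [e1, e2, e3, e4, e5, e6] at h1 h2' h3' ⊢
  rcases neg_one_pow_eq_or K (p * q) with h | h <;>
  rcases neg_one_pow_eq_or K (p * r) with h' | h' <;>
  rcases neg_one_pow_eq_or K (q * r) with h'' | h'' <;>
  simp only [h, h', h''] at h1 h2' h3' ⊢ <;>
  linear_combination (norm := module) h1 - h2' + h3'

end CochainForms

/-! ### Homogeneous elements -/

section Homogeneous

variable {K W : Type*} [CommRing K] [AddCommGroup W] [Module K W]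

theorem lof_mem_homogeneous {p : ℕ} (P : Cochain K W p) :
    DirectSum.lof K ℕ (Cochain K W) p P ∈ homogeneous K W p := fun q hq => by
  rw [DirectSum.lof_eq_of, DirectSum.of_eq_of_ne _ _ _ (by exact_mod_cast hq)]

theorem eq_lof_of_mem_homogeneous {p : ℕ} {f : CochainSpace K W} (hf : f ∈ homogeneous K W p) :
    f = DirectSum.lof K ℕ (Cochain K W) p (f p) := by
  refine DirectSum.ext_component K fun q => ?_
  by_cases h : q = p
  · subst h
    exact (DirectSum.of_eq_same _ _).symm
  · exact (hf q (by exact_mod_cast h)).trans (DirectSum.of_eq_of_ne _ _ _ h).symm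

theorem eq_zero_of_mem_homogeneous {d : ℤ} (hd : d < 0) {f : CochainSpace K W}
    (hf : f ∈ homogeneous K W d) : f = 0 :=
  DirectSum.ext_component K fun q => hf q (by omega)

/-- A homogeneous element is a single cochain. If its degree is negative, it is zero. -/
theorem exists_lof_of_mem_homogeneous {d : ℤ} {f : CochainSpace K W}
    (hf : f ∈ homogeneous K W d) :
    f = 0 ∨ ∃ (p : ℕ) (P : Cochain K W p), d = p ∧ f = DirectSum.lof K ℕ (Cochain K W) p P := by
  rcases lt_or_ge d 0 with h | h
  · exact Or.inl (eq_zero_of_mem_homogeneous h hf)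
  · lift d to ℕ using h
    exact Or.inr ⟨d, _, rfl, eq_lof_of_mem_homogeneous hf⟩

theorem negOnePow_smul_eq {N : Type*} [AddCommGroup N] [Module K N] (n : ℕ) (x : N) :
    (-1 : K) ^ n • x = Int.negOnePow n • x := by
  rw [← neg_one_pow_units_smul, Int.negOnePow_def, zpow_natCast]

theorem signMap_of_mem_homogeneous (e : ℤ) {d : ℤ} {f : CochainSpace K W}
    (hf : f ∈ homogeneous K W d) : signMap e f = Int.negOnePow (e * d) • f := by
  rcases exists_lof_of_mem_homogeneous hf with rfl | ⟨p, P, rfl, rfl⟩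
  · simp
  · rw [signMap, DirectSum.lmap_lof, LinearMap.smul_apply, LinearMap.id_apply, map_smul,
      Int.cast_smul_eq_zsmul, ← Units.smul_def]

theorem units_smul_mem {N : Type*} [AddCommGroup N] [Module K N] (S : Submodule K N) (u : ℤˣ)
    {x : N} (hx : x ∈ S) : u • x ∈ S := by
  rw [Units.smul_def]
  exact zsmul_mem hx _

theorem mnBracket_units_smul_left (u : ℤˣ) (f g : CochainSpace K W) :
    mnBracket (u • f) g = u • mnBracket f g := by
  simp only [Units.smul_def, map_zsmul, LinearMap.smul_apply]

theorem mnBracket_units_smul_right (u : ℤˣ) (f g : CochainSpace K W) :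
    mnBracket f (u • g) = u • mnBracket f g := by
  simp only [Units.smul_def, map_zsmul]

theorem mnBracket_mem_homogeneous {a b : ℤ} {f g : CochainSpace K W}
    (hf : f ∈ homogeneous K W a) (hg : g ∈ homogeneous K W b) :
    mnBracket f g ∈ homogeneous K W (a + b) := by
  rcases exists_lof_of_mem_homogeneous hf with rfl | ⟨p, P, rfl, rfl⟩
  · simp
  rcases exists_lof_of_mem_homogeneous hg with rfl | ⟨q, Q, rfl, rfl⟩
  · simp
  rw [mnBracket_lof_lof]
  refine Submodule.sub_mem _ ?_ (Submodule.smul_mem _ _ ?_)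
  · exact_mod_cast lof_mem_homogeneous (circ p q P Q)
  · rw [add_comm]
    exact_mod_cast lof_mem_homogeneous (circ q p Q P)

theorem mnBracket_comm {a b : ℤ} {f g : CochainSpace K W}
    (hf : f ∈ homogeneous K W a) (hg : g ∈ homogeneous K W b) :
    mnBracket f g = -(Int.negOnePow (a * b) • mnBracket g f) := by
  rcases exists_lof_of_mem_homogeneous hf with rfl | ⟨p, P, rfl, rfl⟩
  · simp
  rcases exists_lof_of_mem_homogeneous hg with rfl | ⟨q, Q, rfl, rfl⟩
  · simp
  rw [mnBracket_lof_comm, negOnePow_smul_eq, Nat.cast_mul]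

theorem mnBracket_jacobi {a b c : ℤ} {f g h : CochainSpace K W}
    (hf : f ∈ homogeneous K W a) (hg : g ∈ homogeneous K W b) (hh : h ∈ homogeneous K W c) :
    mnBracket (mnBracket f g) h =
      mnBracket f (mnBracket g h) + Int.negOnePow (b * c) • mnBracket (mnBracket f h) g := by
  rcases exists_lof_of_mem_homogeneous hf with rfl | ⟨p, P, rfl, rfl⟩
  · simp
  rcases exists_lof_of_mem_homogeneous hg with rfl | ⟨q, Q, rfl, rfl⟩
  · simp
  rcases exists_lof_of_mem_homogeneous hh with rfl | ⟨r, R, rfl, rfl⟩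
  · simp
  rw [mnBracket_lof_jacobi, negOnePow_smul_eq, Nat.cast_mul]

end Homogeneous

/-! ### Bidegrees and the bracket -/

section BidegreeSpaces

variable {K g V : Type*} [CommRing K] [AddCommGroup g] [Module K g] [AddCommGroup V] [Module K V]

/-- A cochain on `g ⊕ V` is determined by its values on arguments each of which lies in one of the
two summands. -/
theorem cochain_ext_summand {p : ℕ} {f f' : Cochain K (g × V) p}
    (h : ∀ (c : Fin p → Bool) (d : Bool) (x : Fin p → g × V) (y : g × V),
      (∀ i, x i ∈ summand K g V (c i)) → y ∈ summand K g V d → f x y = f' x y) : f = f' := by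
  have h1 : ∀ (c : Fin p → Bool) (x : Fin p → g × V), (∀ i, x i ∈ summand K g V (c i)) →
      f x = f' x := by
    intro c x hx
    refine LinearMap.ext fun y => ?_
    have hy : y = (y.1, 0) + (0, y.2) := by simp
    rw [hy, map_add, map_add, h c false x (y.1, 0) hx (by simp [summand]),
      h c true x (0, y.2) hx (by simp [summand])]
  refine AlternatingMap.ext fun x => ?_
  have hx : x = (fun i => ((x i).1, (0 : V))) + fun i => ((0 : g), (x i).2) := by
    funext i
    simp
  rw [hx]
  have e (φ : Cochain K (g × V) p) (m m' : Fin p → g × V) := MultilinearMap.map_add_univ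
    (AlternatingMap.toMultilinearMap (show (g × V) [⋀^Fin p]→ₗ[K] ((g × V) →ₗ[K] (g × V)) from φ))
    m m'
  refine (e f _ _).trans (Eq.trans ?_ (e f' _ _).symm)
  refine Finset.sum_congr rfl fun s _ => ?_
  refine h1 (fun i => decide (i ∉ s)) _ fun i => ?_
  by_cases hi : i ∈ s <;> simp [hi, summand]

theorem mem_bidegreeSpace_induction {j : ℤ} {f : CochainSpace K (g × V)}
    (hf : f ∈ bidegreeSpace K g V j) {N : Type*} [AddCommGroup N] [Module K N]
    (S : Submodule K N) (φ : CochainSpace K (g × V) →ₗ[K] N)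
    (h : ∀ (p : ℕ) (P : Cochain K (g × V) p), HasBidegree ((p : ℤ) + j) (-j) P →
      φ (DirectSum.lof K ℕ (Cochain K (g × V)) p P) ∈ S) : φ f ∈ S := by
  classical
  rw [← DirectSum.sum_support_of f, map_sum]
  exact Submodule.sum_mem _ fun p _ => h p _ (hf p)

/-- The bracket is additive in the bidegree. -/
theorem mnBracket_mem_bidegreeSpace {j j' : ℤ} {f f' : CochainSpace K (g × V)}
    (hf : f ∈ bidegreeSpace K g V j) (hf' : f' ∈ bidegreeSpace K g V j') :
    mnBracket f f' ∈ bidegreeSpace K g V (j + j') := by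
  refine mem_bidegreeSpace_induction hf _ (mnBracket.flip f') fun p P hP => ?_
  refine mem_bidegreeSpace_induction hf' _ (mnBracket (DirectSum.lof K ℕ _ p P)) fun q Q hQ => ?_
  rw [mnBracket_lof_lof]
  refine Submodule.sub_mem _ (lof_mem_bidegreeSpace ?_)
    (Submodule.smul_mem _ _ (lof_mem_bidegreeSpace ?_))
  · convert hP.circ hQ using 1 <;> push_cast <;> ring
  · convert hQ.circ hP using 1 <;> push_cast <;> ring

theorem signMap_mem_bidegreeSpace (e : ℤ) {j : ℤ} {f : CochainSpace K (g × V)}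
    (hf : f ∈ bidegreeSpace K g V j) : signMap e f ∈ bidegreeSpace K g V j := by
  intro p
  rw [signMap, DirectSum.lmap_apply]
  exact (hf p).smul _

/-- There are no nonzero cochains of bidegree `k|-2`. -/
theorem eq_zero_of_mem_bidegreeSpace_two {f : CochainSpace K (g × V)}
    (hf : f ∈ bidegreeSpace K g V 2) : f = 0 := by
  refine DirectSum.ext_component K fun p => cochain_ext_summand fun c d x y hx hy => ?_
  exact ((hf p).2 c d x y hx hy).2.2 (by omega) (by omega)

/-- `h` is an abelian subalgebra. -/
theorem mnBracket_eq_zero_of_mem_HSpace {θ θ' : CochainSpace K (g × V)}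
    (hθ : θ ∈ HSpace K g V) (hθ' : θ' ∈ HSpace K g V) : mnBracket θ θ' = 0 :=
  eq_zero_of_mem_bidegreeSpace_two (mnBracket_mem_bidegreeSpace hθ hθ')

theorem mnBracket_mem_HSpace {f θ : CochainSpace K (g × V)} (hf : f ∈ LPrime K g V)
    (hθ : θ ∈ HSpace K g V) : mnBracket f θ ∈ HSpace K g V := by
  simpa using mnBracket_mem_bidegreeSpace hf hθ

/-- A cochain of bidegree `k|0` takes values in `g` on arguments from `g`, so `P` kills it. -/
theorem projH_of_mem_LPrime {f : CochainSpace K (g × V)} (hf : f ∈ LPrime K g V) :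
    projH K g V f = 0 := by
  refine DirectSum.ext_component K fun p => Cochain.ext fun x y => ?_
  change projH K g V f p x y = 0
  rw [projH, DirectSum.lmap_apply, projCochain_apply]
  have h := ((hf p).2 (fun _ => false) false (fun i => ((x i).1, 0)) (y.1, 0)
    (fun i => by simp [summand]) (by simp [summand])).1 (by simp [numType])
  have h2 : (f p (fun i => ((x i).1, 0)) (y.1, 0)).2 = 0 := by simpa [summand] using h
  rw [h2]
  rfl

theorem projH_of_mem_HSpace {f : CochainSpace K (g × V)} (hf : f ∈ HSpace K g V) :
    projH K g V f = f := by
  refine DirectSum.ext_component K fun p => cochain_ext_summand fun c d x y hx hy => ?_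
  change projH K g V f p x y = f p x y
  have hm := projH_mem_HSpace f p
  obtain ⟨-, h2, h3⟩ := (hf p).2 c d x y hx hy
  by_cases hc : (∃ i, c i = true) ∨ d = true
  · have hn : numType true c d ≠ 0 := by
      unfold numType
      rcases hc with ⟨i, hi⟩ | hd
      · have : 0 < (Finset.univ.filter fun i => c i = true).card :=
          Finset.card_pos.2 ⟨i, by simpa using hi⟩
        omega
      · simp [hd]
    rw [h3 (by omega) (by omega), (hm.2 c d x y hx hy).2.2 (by omega) (by omega)]
  · push Not at hc
    obtain ⟨hc, hd⟩ := hc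
    have hn : numType true c d = 0 := by simp [numType, hc, hd]
    have hs := numType_false_add_true c d
    have h4 := h2 ⟨by omega, by omega⟩
    have h5 : (f p x y).1 = 0 := by simpa [summand] using h4
    have hx0 : (fun i => ((x i).1, (0 : V))) = x := by
      funext i
      have := hx i
      simp only [Bool.not_eq_true] at hc
      rw [hc i] at this
      exact Prod.ext rfl (Eq.symm (by simpa [summand] using this))
    have hy0 : (y.1, (0 : V)) = y := by
      simp only [Bool.not_eq_true] at hd
      rw [hd] at hy
      exact Prod.ext rfl (Eq.symm (by simpa [summand] using hy))
    rw [projH, DirectSum.lmap_apply, projCochain_apply, hx0, hy0]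
    exact Prod.ext h5.symm rfl

end BidegreeSpaces

/-! ### The derived brackets -/

section ControlBrackets

variable {K g V : Type*} [CommRing K] [AddCommGroup g] [Module K g] [AddCommGroup V] [Module K V]

/-- The value of `derivedTerm` if the entry `f_i` is a single cochain. -/
theorem derivedTerm_of_eq_lof {k : ℕ} {i : Fin (k + 1)} {x : Fin (k + 1) → ControlSpace K g V}
    {p : ℕ} {P : Cochain K (g × V) p}
    (h : ((x i).1 : CochainSpace K (g × V)) = DirectSum.lof K ℕ (Cochain K (g × V)) p P) :
    derivedTerm K g V k i x = iteratedBracket k (DirectSum.lof K ℕ (Cochain K (g × V)) p P)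
      fun j => (if i.succAbove j < i then signMap ((p : ℤ) - 1) else LinearMap.id)
        ((x (i.succAbove j)).2 : CochainSpace K (g × V)) := by
  rw [derivedTerm, LinearMap.uncurryMid_apply, LinearMap.comp_apply, LinearMap.comp_apply,
    LinearMap.fst_apply, Submodule.subtype_apply, h, DirectSum.toModule_lof]
  rfl

theorem derivedTerm_of_eq_zero {k : ℕ} {i : Fin (k + 1)} {x : Fin (k + 1) → ControlSpace K g V}
    (h : (x i).1 = 0) : derivedTerm K g V k i x = 0 := by
  rw [derivedTerm, LinearMap.uncurryMid_apply, LinearMap.comp_apply, LinearMap.comp_apply,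
    LinearMap.fst_apply, h, map_zero, map_zero, zero_apply]

/-- The value of `derivedTerm` as a sum over the components of the entry `f_i`. -/
theorem derivedTerm_eq_sum [∀ p, DecidableEq (Cochain K (g × V) p)] (k : ℕ) (i : Fin (k + 1))
    (x : Fin (k + 1) → ControlSpace K g V) :
    derivedTerm K g V k i x = ∑ p ∈ DFinsupp.support ((x i).1 : CochainSpace K (g × V)),
      iteratedBracket k
        (DirectSum.lof K ℕ (Cochain K (g × V)) p (((x i).1 : CochainSpace K (g × V)) p))
        fun j => (if i.succAbove j < i then signMap ((p : ℤ) - 1) else LinearMap.id)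
          ((x (i.succAbove j)).2 : CochainSpace K (g × V)) := by
  rw [derivedTerm, LinearMap.uncurryMid_apply, LinearMap.comp_apply, LinearMap.comp_apply,
    LinearMap.fst_apply, Submodule.subtype_apply]
  conv_lhs => rw [← DirectSum.sum_support_of ((x i).1 : CochainSpace K (g × V))]
  rw [map_sum, sum_apply]
  refine Finset.sum_congr rfl fun p _ => ?_
  rw [← DirectSum.lof_eq_of K, DirectSum.toModule_lof]
  rfl

theorem derivedTerm_zero_mem_LPrime (i : Fin 1) (x : Fin 1 → ControlSpace K g V) :
    derivedTerm K g V 0 i x ∈ LPrime K g V := by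
  classical
  rw [derivedTerm_eq_sum]
  exact Submodule.sum_mem _ fun p _ => lof_mem_bidegreeSpace ((x i).1.2 p)

/-- Bracketing an element of `L'` with two elements of `h` gives zero. -/
theorem derivedTerm_add_two (k : ℕ) (i : Fin (k + 3)) (x : Fin (k + 3) → ControlSpace K g V) :
    derivedTerm K g V (k + 2) i x = 0 := by
  classical
  rw [derivedTerm_eq_sum]
  refine Finset.sum_eq_zero fun p _ => ?_
  rw [iteratedBracket_succ_apply, iteratedBracket_succ_apply, mnBracket_eq_zero_of_mem_HSpace,
    map_zero, zero_apply]
  · refine mnBracket_mem_HSpace (lof_mem_bidegreeSpace ((x i).1.2 p)) ?_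
    split_ifs
    · exact signMap_mem_bidegreeSpace _ (Subtype.prop _)
    · exact Subtype.prop _
  · rw [Fin.tail]
    split_ifs
    · exact signMap_mem_bidegreeSpace _ (Subtype.prop _)
    · exact Subtype.prop _

theorem derivedTerm_one_zero (x : Fin 2 → ControlSpace K g V) :
    derivedTerm K g V 1 0 x =
      mnBracket ((x 0).1 : CochainSpace K (g × V)) ((x 1).2 : CochainSpace K (g × V)) := by
  classical
  rw [derivedTerm_eq_sum]
  conv_rhs => rw [← DirectSum.sum_support_of ((x 0).1 : CochainSpace K (g × V))]
  rw [map_sum, LinearMap.sum_apply]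
  rfl

theorem derivedTerm_one_one (x : Fin 2 → ControlSpace K g V) {d d' : ℤ}
    (hf : ((x 1).1 : CochainSpace K (g × V)) ∈ homogeneous K (g × V) (d' + 1))
    (hθ : ((x 0).2 : CochainSpace K (g × V)) ∈ homogeneous K (g × V) d) :
    derivedTerm K g V 1 1 x = Int.negOnePow (d * d') •
      mnBracket ((x 1).1 : CochainSpace K (g × V)) ((x 0).2 : CochainSpace K (g × V)) := by
  rcases exists_lof_of_mem_homogeneous hf with h | ⟨p, P, hp, h⟩
  · rw [derivedTerm_of_eq_zero (Subtype.ext h), h, map_zero, LinearMap.zero_apply, smul_zero]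
  · rw [derivedTerm_of_eq_lof h, iteratedBracket_succ_apply, iteratedBracket_zero_apply, h]
    have e : (1 : Fin 2).succAbove 0 = 0 := rfl
    rw [e, if_pos (by decide), signMap_of_mem_homogeneous _ hθ, mnBracket_units_smul_right,
      show (p : ℤ) - 1 = d' by omega, mul_comm]

/-- `l_1` vanishes because `P` kills `L'`, and `l_k` for `k ≥ 3` because `[[L', h], h] = 0`. -/
theorem controlBracket_eq_zero {k : ℕ} (hk : 1 ≤ k) (hk2 : k ≠ 2) :
    controlBracket K g V k = 0 := by
  have e (k : ℕ) : controlBracket K g V (k + 1) =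
    (LinearMap.inl K (LPrime K g V) (HSpace K g V)).compMultilinearMap
        (controlBracketShifted K g V (k + 1)) +
      (LinearMap.inr K (LPrime K g V) (HSpace K g V) ∘ₗ projToH K g V).compMultilinearMap
        (∑ i : Fin (k + 1), derivedTerm K g V k i) := rfl
  match k, hk, hk2 with
  | 1, _, _ =>
    refine MultilinearMap.ext fun x => Prod.ext (Subtype.ext ?_) (Subtype.ext ?_)
    · rw [e]
      simp [controlBracketShifted]
    · rw [e]
      simp [projToH, projH_of_mem_LPrime (derivedTerm_zero_mem_LPrime _ x)]
  | k + 3, _, _ =>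
    refine MultilinearMap.ext fun x => ?_
    rw [e]
    simp [controlBracketShifted, derivedTerm_add_two]

theorem controlBracket_two_fst (x : Fin 2 → ControlSpace K g V) :
    ((controlBracket K g V 2 x).1 : CochainSpace K (g × V)) =
      mnBracket (signMap 1 ((x 0).1 : CochainSpace K (g × V))) (x 1).1 := by
  change ((shiftedBracket K g V (x 0).1 (x 1).1 + 0 : LPrime K g V) : CochainSpace K (g × V)) = _
  rw [add_zero]
  rfl

theorem controlBracket_two_snd (x : Fin 2 → ControlSpace K g V) :
    ((controlBracket K g V 2 x).2 : CochainSpace K (g × V)) =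
      projH K g V (derivedTerm K g V 1 0 x + derivedTerm K g V 1 1 x) := by
  change ((0 + projToH K g V ((∑ i : Fin 2, derivedTerm K g V 1 i) x) : HSpace K g V) :
    CochainSpace K (g × V)) = _
  rw [zero_add, Fin.sum_univ_two]
  rfl

theorem mem_controlGrading {d : ℤ} {x : ControlSpace K g V} :
    x ∈ controlGrading K g V d ↔
      (x.1 : CochainSpace K (g × V)) ∈ homogeneous K (g × V) (d + 1) ∧
        (x.2 : CochainSpace K (g × V)) ∈ homogeneous K (g × V) d := Iff.rfl

/-- The components of the binary bracket of homogeneous elements. -/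
theorem controlBracket_two_of_mem {x : Fin 2 → ControlSpace K g V} {d : Fin 2 → ℤ}
    (hx : ∀ i, x i ∈ controlGrading K g V (d i)) :
    ((controlBracket K g V 2 x).1 : CochainSpace K (g × V)) =
        Int.negOnePow (d 0 + 1) •
          mnBracket ((x 0).1 : CochainSpace K (g × V)) ((x 1).1 : CochainSpace K (g × V)) ∧
      ((controlBracket K g V 2 x).2 : CochainSpace K (g × V)) =
        mnBracket ((x 0).1 : CochainSpace K (g × V)) ((x 1).2 : CochainSpace K (g × V)) +
          Int.negOnePow (d 0 * d 1) •
            mnBracket ((x 1).1 : CochainSpace K (g × V)) ((x 0).2 : CochainSpace K (g × V)) := by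
  simp only [mem_controlGrading] at hx
  constructor
  · rw [controlBracket_two_fst, signMap_of_mem_homogeneous 1 (hx 0).1, mnBracket_units_smul_left,
      one_mul]
  · rw [controlBracket_two_snd, derivedTerm_one_zero, derivedTerm_one_one x (hx 1).1 (hx 0).2]
    exact projH_of_mem_HSpace (Submodule.add_mem _
      (mnBracket_mem_HSpace (x 0).1.2 (x 1).2.2)
      (units_smul_mem _ _ (mnBracket_mem_HSpace (x 1).1.2 (x 0).2.2)))

theorem controlBracket_two_mem {x : Fin 2 → ControlSpace K g V} {d : Fin 2 → ℤ}
    (hx : ∀ i, x i ∈ controlGrading K g V (d i)) :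
    controlBracket K g V 2 x ∈ controlGrading K g V (d 0 + d 1 + 1) := by
  obtain ⟨h1, h2⟩ := controlBracket_two_of_mem hx
  simp only [mem_controlGrading] at hx
  rw [mem_controlGrading, h1, h2]
  refine ⟨?_, Submodule.add_mem _ ?_ (units_smul_mem _ _ ?_)⟩
  · rw [show d 0 + d 1 + 1 + 1 = (d 0 + 1) + (d 1 + 1) by ring]
    exact units_smul_mem _ _ (mnBracket_mem_homogeneous (hx 0).1 (hx 1).1)
  · rw [show d 0 + d 1 + 1 = (d 0 + 1) + d 1 by ring]
    exact mnBracket_mem_homogeneous (hx 0).1 (hx 1).2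
  · rw [show d 0 + d 1 + 1 = (d 1 + 1) + d 0 by ring]
    exact mnBracket_mem_homogeneous (hx 1).1 (hx 0).2

end ControlBrackets

/-! ### The grading of `s⁻¹L' ⊕ h` -/

section Grading

variable {K W : Type*} [CommRing K] [AddCommGroup W] [Module K W]

/-- The projection onto the component of degree `d`. -/
def homogeneousProj (d : ℤ) : CochainSpace K W →ₗ[K] CochainSpace K W :=
  if 0 ≤ d then DirectSum.lof K ℕ (Cochain K W) d.toNat ∘ₗ
    DirectSum.component K ℕ (Cochain K W) d.toNat else 0

theorem homogeneousProj_self {d : ℤ} {f : CochainSpace K W} (hf : f ∈ homogeneous K W d) :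
    homogeneousProj d f = f := by
  rcases exists_lof_of_mem_homogeneous hf with rfl | ⟨p, P, rfl, rfl⟩
  · simp
  · simp [homogeneousProj, DirectSum.component.lof_self]

theorem homogeneousProj_of_ne {d e : ℤ} (h : e ≠ d) {f : CochainSpace K W}
    (hf : f ∈ homogeneous K W e) : homogeneousProj d f = 0 := by
  unfold homogeneousProj
  split_ifs with hd
  · have : f d.toNat = 0 := hf _ (by omega)
    rw [LinearMap.comp_apply, DirectSum.apply_eq_component K] at *
    rw [this, map_zero]
  · rfl

variable {g V : Type*} [AddCommGroup g] [Module K g] [AddCommGroup V] [Module K V]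

theorem eq_sum_lof_of_mem_bidegreeSpace [∀ p, DecidableEq (Cochain K (g × V) p)] {j : ℤ}
    (f : bidegreeSpace K g V j) :
    f = ∑ p ∈ DFinsupp.support (f : CochainSpace K (g × V)),
      ⟨DirectSum.lof K ℕ (Cochain K (g × V)) p ((f : CochainSpace K (g × V)) p),
        lof_mem_bidegreeSpace (f.2 p)⟩ := by
  apply Subtype.ext
  conv_lhs => rw [← DirectSum.sum_support_of (f : CochainSpace K (g × V))]
  rw [AddSubmonoidClass.coe_finsetSum]
  rfl

/-- `s⁻¹L' ⊕ h` is the direct sum of its homogeneous components. -/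
theorem isInternal_controlGrading : DirectSum.IsInternal (controlGrading K g V) := by
  classical
  rw [DirectSum.isInternal_submodule_iff_iSupIndep_and_iSup_eq_top]
  constructor
  · intro d
    let φ : ControlSpace K g V →ₗ[K] CochainSpace K (g × V) × CochainSpace K (g × V) :=
      (homogeneousProj (d + 1) ∘ₗ (LPrime K g V).subtype).prodMap
        (homogeneousProj d ∘ₗ (HSpace K g V).subtype)
    have h : ⨆ (e : ℤ) (_ : e ≠ d), controlGrading K g V e ≤ LinearMap.ker φ := by
      refine iSup₂_le fun e he x hx => ?_
      rw [mem_controlGrading] at hx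
      exact Prod.ext (homogeneousProj_of_ne (by omega) hx.1) (homogeneousProj_of_ne he hx.2)
    rw [Submodule.disjoint_def]
    intro x hx hx'
    have h0 : φ x = 0 := h hx'
    rw [mem_controlGrading] at hx
    exact Prod.ext
      (Subtype.ext ((homogeneousProj_self hx.1).symm.trans (congrArg Prod.fst h0)))
      (Subtype.ext ((homogeneousProj_self hx.2).symm.trans (congrArg Prod.snd h0)))
  · rw [eq_top_iff]
    rintro ⟨f, θ⟩ -
    have e : ((f, θ) : ControlSpace K g V) = LinearMap.inl K _ _ f + LinearMap.inr K _ _ θ := by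
      simp
    rw [e, eq_sum_lof_of_mem_bidegreeSpace f, eq_sum_lof_of_mem_bidegreeSpace θ, map_sum, map_sum]
    refine Submodule.add_mem _ (Submodule.sum_mem _ fun p _ => ?_)
      (Submodule.sum_mem _ fun p _ => ?_)
    · refine Submodule.mem_iSup_of_mem ((p : ℤ) - 1) (mem_controlGrading.2 ⟨?_, ?_⟩)
      · rw [sub_add_cancel]
        exact lof_mem_homogeneous _
      · exact Submodule.zero_mem _
    · refine Submodule.mem_iSup_of_mem (p : ℤ) (mem_controlGrading.2 ⟨?_, ?_⟩)
      · exact Submodule.zero_mem _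
      · exact lof_mem_homogeneous _

end Grading

/-! ### The binary bracket -/

section LInfinityStructure

/-- The sign `(-1)^{ab}` in terms of `(-1)^a` and `(-1)^b`, which makes sign identities a finite
check. -/
theorem negOnePow_mul_eq (a b : ℤ) :
    Int.negOnePow (a * b) = if Int.negOnePow a = 1 then 1 else Int.negOnePow b := by
  rcases Int.even_or_odd a with h | h
  · rw [Int.negOnePow_even _ h, Int.negOnePow_even _ (h.mul_right b), if_pos rfl]
  · rw [Int.negOnePow_odd _ h, if_neg (by decide)]
    rcases Int.even_or_odd b with h' | h'
    · rw [Int.negOnePow_even _ h', Int.negOnePow_even _ (h'.mul_left a)]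
    · rw [Int.negOnePow_odd _ h', Int.negOnePow_odd _ (h.mul h')]

variable {K W : Type*} [CommRing K] [AddCommGroup W] [Module K W]

/-- The graded Jacobi identity in Leibniz form. -/
theorem mnBracket_leibniz {a b c : ℤ} {f g h : CochainSpace K W}
    (hf : f ∈ homogeneous K W a) (hg : g ∈ homogeneous K W b) (hh : h ∈ homogeneous K W c) :
    mnBracket (mnBracket f g) h =
      mnBracket f (mnBracket g h) - Int.negOnePow (a * b) • mnBracket g (mnBracket f h) := by
  rw [mnBracket_jacobi hf hg hh, mnBracket_comm (mnBracket_mem_homogeneous hf hh) hg]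
  simp only [negOnePow_mul_eq, Int.negOnePow_add]
  rcases Int.units_eq_one_or (Int.negOnePow a) with ha | ha <;>
  rcases Int.units_eq_one_or (Int.negOnePow b) with hb | hb <;>
  rcases Int.units_eq_one_or (Int.negOnePow c) with hc | hc <;>
  simp [ha, hb, hc, (by decide : (-1 : ℤˣ) ≠ 1)] <;> abel

variable {g V : Type*} [AddCommGroup g] [Module K g] [AddCommGroup V] [Module K V]

/-- Graded symmetry of the binary bracket. -/
theorem controlBracket_two_symm {x : Fin 2 → ControlSpace K g V} {d : Fin 2 → ℤ}
    (hx : ∀ i, x i ∈ controlGrading K g V (d i)) (σ : Equiv.Perm (Fin 2)) :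
    controlBracket K g V 2 (fun i => x (σ i)) = koszulSign d σ • controlBracket K g V 2 x := by
  have hσ : σ = 1 ∨ σ = Equiv.swap 0 1 := by
    revert σ
    decide
  obtain ⟨h1, h2⟩ := controlBracket_two_of_mem hx
  obtain ⟨h3, h4⟩ := controlBracket_two_of_mem (x := fun i => x (σ i)) fun i => hx (σ i)
  simp only [mem_controlGrading] at hx
  rcases hσ with rfl | rfl
  · simp [koszulSign]
  · have e : koszulSign d (Equiv.swap 0 1) = Int.negOnePow (d 0 * d 1) := by
      simp [koszulSign, Fin.prod_univ_two, mul_comm]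
    rw [e]
    refine Prod.ext (Subtype.ext ?_) (Subtype.ext ?_)
    · rw [h3]
      change _ = Int.negOnePow (d 0 * d 1) • ((controlBracket K g V 2 x).1 : CochainSpace K (g × V))
      rw [h1]
      simp only [Equiv.swap_apply_left, Equiv.swap_apply_right]
      rw [mnBracket_comm (hx 1).1 (hx 0).1]
      simp only [negOnePow_mul_eq, Int.negOnePow_add]
      rcases Int.units_eq_one_or (Int.negOnePow (d 0)) with ha | ha <;>
      rcases Int.units_eq_one_or (Int.negOnePow (d 1)) with hb | hb <;>
      simp [ha, hb, (by decide : (-1 : ℤˣ) ≠ 1)]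
    · rw [h4]
      change _ = Int.negOnePow (d 0 * d 1) • ((controlBracket K g V 2 x).2 : CochainSpace K (g × V))
      rw [h2]
      simp only [Equiv.swap_apply_left, Equiv.swap_apply_right]
      rw [mul_comm (d 1), smul_add, smul_smul, Int.units_mul_self, one_smul, add_comm]

/-- The components of an iterated binary bracket of homogeneous elements. -/
theorem controlBracket_controlBracket {x y z : ControlSpace K g V} {a b c : ℤ}
    (hx : x ∈ controlGrading K g V a) (hy : y ∈ controlGrading K g V b)
    (hz : z ∈ controlGrading K g V c) :
    ((controlBracket K g V 2 ![controlBracket K g V 2 ![x, y], z]).1 : CochainSpace K (g × V)) =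
        (Int.negOnePow (a + b + 1 + 1) * Int.negOnePow (a + 1)) •
          mnBracket (mnBracket (x.1 : CochainSpace K (g × V)) (y.1 : CochainSpace K (g × V)))
            (z.1 : CochainSpace K (g × V)) ∧
      ((controlBracket K g V 2 ![controlBracket K g V 2 ![x, y], z]).2 :
          CochainSpace K (g × V)) =
        Int.negOnePow (a + 1) • mnBracket (mnBracket (x.1 : CochainSpace K (g × V))
            (y.1 : CochainSpace K (g × V))) (z.2 : CochainSpace K (g × V)) +
          Int.negOnePow ((a + b + 1) * c) • (mnBracket (z.1 : CochainSpace K (g × V))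
            (mnBracket (x.1 : CochainSpace K (g × V)) (y.2 : CochainSpace K (g × V))) +
          Int.negOnePow (a * b) • mnBracket (z.1 : CochainSpace K (g × V))
            (mnBracket (y.1 : CochainSpace K (g × V)) (x.2 : CochainSpace K (g × V)))) := by
  have hxy : ∀ i, ![x, y] i ∈ controlGrading K g V (![a, b] i) := by
    simp [Fin.forall_fin_two, hx, hy]
  have h := controlBracket_two_mem hxy
  have hz' : ∀ i, ![controlBracket K g V 2 ![x, y], z] i ∈
      controlGrading K g V (![a + b + 1, c] i) := by
    simpa [Fin.forall_fin_two, hz] using h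
  obtain ⟨h1, h2⟩ := controlBracket_two_of_mem hxy
  obtain ⟨h3, h4⟩ := controlBracket_two_of_mem hz'
  simp only [Matrix.cons_val_zero, Matrix.cons_val_one] at h1 h2 h3 h4
  rw [h3, h4, h1, h2]
  simp only [mnBracket_units_smul_left, mnBracket_units_smul_right, map_add, smul_smul, smul_add,
    and_self]

/-- The Jacobi identity for the binary bracket. -/
theorem controlBracket_jacobi {x y z : ControlSpace K g V} {a b c : ℤ}
    (hx : x ∈ controlGrading K g V a) (hy : y ∈ controlGrading K g V b)
    (hz : z ∈ controlGrading K g V c) :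
    controlBracket K g V 2 ![controlBracket K g V 2 ![x, y], z] +
      Int.negOnePow (b * c) • controlBracket K g V 2 ![controlBracket K g V 2 ![x, z], y] +
      (Int.negOnePow (a * b) * Int.negOnePow (a * c)) •
        controlBracket K g V 2 ![controlBracket K g V 2 ![y, z], x] = 0 := by
  obtain ⟨h1, h2⟩ := controlBracket_controlBracket hx hy hz
  obtain ⟨h3, h4⟩ := controlBracket_controlBracket hx hz hy
  obtain ⟨h5, h6⟩ := controlBracket_controlBracket hy hz hx
  rw [mem_controlGrading] at hx hy hz
  refine Prod.ext (Subtype.ext ?_) (Subtype.ext ?_)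
  · change ((controlBracket K g V 2 ![controlBracket K g V 2 ![x, y], z]).1 :
        CochainSpace K (g × V)) + Int.negOnePow (b * c) •
      ((controlBracket K g V 2 ![controlBracket K g V 2 ![x, z], y]).1 : CochainSpace K (g × V)) +
      (Int.negOnePow (a * b) * Int.negOnePow (a * c)) •
      ((controlBracket K g V 2 ![controlBracket K g V 2 ![y, z], x]).1 :
        CochainSpace K (g × V)) = 0
    rw [h1, h3, h5, mnBracket_leibniz hx.1 hy.1 hz.1,
      mnBracket_comm (mnBracket_mem_homogeneous hx.1 hz.1) hy.1,
      mnBracket_comm (mnBracket_mem_homogeneous hy.1 hz.1) hx.1]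
    simp only [negOnePow_mul_eq, Int.negOnePow_add]
    rcases Int.units_eq_one_or (Int.negOnePow a) with ha | ha <;>
    rcases Int.units_eq_one_or (Int.negOnePow b) with hb | hb <;>
    rcases Int.units_eq_one_or (Int.negOnePow c) with hc | hc <;>
    simp [ha, hb, hc, (by decide : (-1 : ℤˣ) ≠ 1)]
    all_goals abel
  · change ((controlBracket K g V 2 ![controlBracket K g V 2 ![x, y], z]).2 :
        CochainSpace K (g × V)) + Int.negOnePow (b * c) •
      ((controlBracket K g V 2 ![controlBracket K g V 2 ![x, z], y]).2 : CochainSpace K (g × V)) +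
      (Int.negOnePow (a * b) * Int.negOnePow (a * c)) •
      ((controlBracket K g V 2 ![controlBracket K g V 2 ![y, z], x]).2 :
        CochainSpace K (g × V)) = 0
    rw [h2, h4, h6, mnBracket_leibniz hx.1 hy.1 hz.2, mnBracket_leibniz hx.1 hz.1 hy.2,
      mnBracket_leibniz hy.1 hz.1 hx.2]
    simp only [negOnePow_mul_eq, Int.negOnePow_add]
    rcases Int.units_eq_one_or (Int.negOnePow a) with ha | ha <;>
    rcases Int.units_eq_one_or (Int.negOnePow b) with hb | hb <;>
    rcases Int.units_eq_one_or (Int.negOnePow c) with hc | hc <;>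
    simp [ha, hb, hc, (by decide : (-1 : ℤˣ) ≠ 1)]
    all_goals abel

end LInfinityStructure

/-! ### The `L_∞`-algebra -/

section LInfinityAlgebra

variable {K g V : Type*} [Field K] [AddCommGroup g] [Module K g] [AddCommGroup V] [Module K V]

/-- The `(2, 1)`-unshuffles. -/
theorem filter_isUnshuffle_two_one :
    (Finset.univ.filter fun σ : Equiv.Perm (Fin 3) => IsUnshuffle (blocksTwo (1 + 1) 3) σ) =
      {1, Equiv.swap 1 2, finRotate 3} := by
  decide

theorem koszulSign_one {n : ℕ} (d : Fin n → ℤ) : koszulSign d 1 = 1 := by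
  refine Finset.prod_eq_one fun i _ => Finset.prod_eq_one fun j _ => if_neg ?_
  simp only [Equiv.Perm.one_apply]
  exact fun h => lt_asymm h.1 h.2

theorem koszulSign_swap_one_two (d : Fin 3 → ℤ) :
    koszulSign d (Equiv.swap 1 2) = Int.negOnePow (d 1 * d 2) := by
  have h0 : Equiv.swap (1 : Fin 3) 2 0 = 0 := by decide
  simp [koszulSign, Fin.prod_univ_three, h0, mul_comm]

theorem koszulSign_finRotate_three (d : Fin 3 → ℤ) :
    koszulSign d (finRotate 3) = Int.negOnePow (d 0 * d 1) * Int.negOnePow (d 0 * d 2) := by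
  simp [koszulSign, Fin.prod_univ_three, mul_comm]

theorem sum_controlBracket_controlBracket {d : Fin 3 → ℤ} {x : Fin 3 → ControlSpace K g V}
    (hx : ∀ i, x i ∈ controlGrading K g V (d i)) :
    ∑ σ : Equiv.Perm (Fin 3) with IsUnshuffle (blocksTwo (1 + 1) 3) σ, koszulSign d σ •
      controlBracket K g V 2 ![controlBracket K g V 2 ![x (σ 0), x (σ 1)], x (σ 2)] = 0 := by
  have hne : (1 : Equiv.Perm (Fin 3)) ≠ Equiv.swap 1 2 ∧
      (1 : Equiv.Perm (Fin 3)) ≠ finRotate 3 ∧ Equiv.swap 1 2 ≠ finRotate 3 := by decide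
  have h0 : Equiv.swap (1 : Fin 3) 2 0 = 0 := by decide
  have r0 : finRotate 3 0 = 1 := by decide
  have r1 : finRotate 3 1 = 2 := by decide
  have r2 : finRotate 3 2 = 0 := by decide
  rw [filter_isUnshuffle_two_one, Finset.sum_insert (by simp [hne.1, hne.2.1]),
    Finset.sum_insert (by simp [hne.2.2]), Finset.sum_singleton, koszulSign_one,
    koszulSign_swap_one_two, koszulSign_finRotate_three, one_smul, ← add_assoc, h0,
    Equiv.swap_apply_left, Equiv.swap_apply_right, r0, r1, r2]
  exact controlBracket_jacobi (hx 0) (hx 1) (hx 2)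

theorem isLInfinityAlgebra_control :
    IsLInfinityAlgebra (controlGrading K g V) (controlBracket K g V) where
  isInternal := isInternal_controlGrading
  degree_one n hn d x hx := by
    by_cases h : n = 2
    · subst h
      rw [Fin.sum_univ_two]
      exact controlBracket_two_mem hx
    · rw [controlBracket_eq_zero hn h]
      exact Submodule.zero_mem _
  graded_symmetry n hn d x hx σ := by
    by_cases h : n = 2
    · subst h
      exact controlBracket_two_symm hx σ
    · rw [controlBracket_eq_zero hn h, zero_apply, zero_apply, smul_zero]
  generalized_jacobi n hn d x hx := by
    -- Only the composition of two binary brackets survives.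
    have hvan : ∀ i : Fin n, ¬((i : ℕ) = 1 ∧ n = 3) →
        ∑ σ : Equiv.Perm (Fin n) with IsUnshuffle (blocksTwo (i + 1) n) σ,
          koszulSign d σ • controlBracket K g V (n - (i + 1) + 1)
            (Fin.cons (controlBracket K g V (i + 1) (permInit x σ (i + 1) i.isLt))
              (permTail x σ (i + 1))) = 0 := by
      intro i hi
      refine Finset.sum_eq_zero fun σ _ => ?_
      by_cases h1 : (i : ℕ) + 1 = 2
      · rw [controlBracket_eq_zero (k := n - (i + 1) + 1) (by omega) (by omega), zero_apply,
          smul_zero]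
      · rw [controlBracket_eq_zero (k := i + 1) (by omega) h1, zero_apply,
          (controlBracket K g V _).map_coord_zero 0 rfl, smul_zero]
    by_cases h : n = 3
    · subst h
      have e (σ : Equiv.Perm (Fin 3)) :
          (Fin.cons (controlBracket K g V (1 + 1) (permInit x σ (1 + 1) (by decide)))
            (permTail x σ (1 + 1)) : Fin (3 - (1 + 1) + 1) → ControlSpace K g V) =
          ![controlBracket K g V 2 ![x (σ 0), x (σ 1)], x (σ 2)] := by
        have e1 : permInit x σ (1 + 1) (by decide) = ![x (σ 0), x (σ 1)] := by
          funext k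
          fin_cases k <;> rfl
        rw [e1]
        funext k
        fin_cases k <;> rfl
      rw [Finset.sum_eq_single 1 (fun i _ hi => hvan i fun h => hi (Fin.ext h.1)) (by simp)]
      refine (Finset.sum_congr rfl fun σ _ => ?_).trans (sum_controlBracket_controlBracket hx)
      exact congrArg (koszulSign d σ • ·) (congrArg (controlBracket K g V 2) (e σ))
    · exact Finset.sum_eq_zero fun i _ => hvan i fun hi => h hi.2

end LInfinityAlgebra

/-! ### Compositions in low degree -/

section LowDegree

variable {K W : Type*} [CommRing K] [AddCommGroup W] [Module K W]

/-- The antisymmetrized associator of the product `M`. -/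
theorem compForm_one_one {M : List W → Module.End K W} (hM : IsConcentrated 1 M)
    (sM : IsSkewForm K M) (x₁ x₂ y : W) :
    compForm 1 1 M M [x₁, x₂] y =
      M [M [x₁] x₂] y - M [M [x₂] x₁] y - (M [x₁] (M [x₂] y) - M [x₂] (M [x₁] y)) := by
  have h2 (a b : W) (l : List W) : M (a :: b :: l) = 0 := hM _ (by simp)
  have hsub (u v : W) : M [u + -v] = M [u] - M [v] := by
    rw [sM.map_add, ← neg_one_smul K v, sM.map_smul, neg_one_smul, sub_eq_add_neg]
  simp [compForm_apply, insertForm, actForm, vectorForm, shuffleSum_cons, shuffleSum_nil, idForm,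
    hsub, h2]
  abel

theorem compForm_one_zero {M N : List W → Module.End K W} (hM : IsConcentrated 1 M)
    (hN : IsConcentrated 0 N) (x y : W) :
    compForm 1 0 M N [x] y = M [N [] x] y + M [x] (N [] y) := by
  have h1 (a : W) (l : List W) : N (a :: l) = 0 := hN _ (by simp)
  have h2 (a b : W) (l : List W) : M (a :: b :: l) = 0 := hM _ (by simp)
  simp [compForm_apply, insertForm, actForm, vectorForm, shuffleSum_cons, shuffleSum_nil, idForm,
    h1, h2]

theorem compForm_zero_one {M N : List W → Module.End K W}
    (hN : IsConcentrated 0 N) (x y : W) :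
    compForm 0 1 N M [x] y = N [] (M [x] y) := by
  have h1 (a : W) (l : List W) : N (a :: l) = 0 := hN _ (by simp)
  simp [compForm_apply, insertForm, actForm, vectorForm, shuffleSum_cons, shuffleSum_nil, idForm,
    h1]

theorem lof_eq_zero_iff_one {F : Cochain K W 1} :
    DirectSum.lof K ℕ (Cochain K W) 1 F = 0 ↔
      ∀ x y, toForm (DirectSum.lof K ℕ (Cochain K W) 1 F) [x] y = 0 := by
  refine ⟨fun h x y => by rw [h]; rfl, fun h => cochainSpace_ext fun l y => ?_⟩
  match l with
  | [x] => exact h x y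
  | [] => rw [isConcentrated_toForm_lof F _ (by simp)]; rfl
  | _ :: _ :: _ => rw [isConcentrated_toForm_lof F _ (by simp)]; rfl

theorem lof_eq_zero_iff_two {F : Cochain K W 2} :
    DirectSum.lof K ℕ (Cochain K W) 2 F = 0 ↔
      ∀ x₁ x₂ y, toForm (DirectSum.lof K ℕ (Cochain K W) 2 F) [x₁, x₂] y = 0 := by
  refine ⟨fun h x₁ x₂ y => by rw [h]; rfl, fun h => cochainSpace_ext fun l y => ?_⟩
  match l with
  | [x₁, x₂] => exact h x₁ x₂ y
  | [] => rw [isConcentrated_toForm_lof F _ (by simp)]; rfl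
  | [_] => rw [isConcentrated_toForm_lof F _ (by simp)]; rfl
  | _ :: _ :: _ :: _ => rw [isConcentrated_toForm_lof F _ (by simp)]; rfl

end LowDegree

/-! ### Maurer–Cartan elements -/

section MaurerCartan

variable {K g V : Type*} [Field K] [AddCommGroup g] [Module K g] [AddCommGroup V] [Module K V]

/-- The product of the semidirect product `g ⊕ V`. -/
def semidirectProduct (π : g →ₗ[K] g →ₗ[K] g) (ρ μ : g →ₗ[K] Module.End K V) (x y : g × V) :
    g × V :=
  (π x.1 y.1, ρ x.1 y.2 + μ y.1 x.2)

theorem toForm_structureElement (π : g →ₗ[K] g →ₗ[K] g) (ρ μ : g →ₗ[K] Module.End K V)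
    (x y : g × V) :
    toForm (structureElement π ρ μ : CochainSpace K (g × V)) [x] y =
      semidirectProduct π ρ μ x y := by
  have h := toForm_lof (liftPi π + liftRho ρ + liftMu μ : Cochain K (g × V) 1) ![x]
  have e : List.ofFn ![x] = [x] := by simp
  rw [e] at h
  refine (LinearMap.congr_fun h y).trans ?_
  simp only [Cochain.add_apply, LinearMap.add_apply, liftPi_apply, liftRho_apply, liftMu_apply]
  simp [semidirectProduct]

theorem toForm_derivationElement (D : g →ₗ[K] V) (y : g × V) :
    toForm (derivationElement D : CochainSpace K (g × V)) [] y = (0, D y.1) :=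
  LinearMap.congr_fun (toForm_lof (liftD D : Cochain K (g × V) 0) ![]) y

/-- `[π + ρ + μ, π + ρ + μ] = 0` says that the product of `g ⊕ V` is pre-Lie, which splits into the
pre-Lie identity on `g` and the axioms of a representation. -/
theorem mnBracket_structureElement [CharZero K] (π : g →ₗ[K] g →ₗ[K] g)
    (ρ μ : g →ₗ[K] Module.End K V) :
    mnBracket (structureElement π ρ μ : CochainSpace K (g × V)) (structureElement π ρ μ) = 0 ↔
      IsPreLieAlgebra π ∧ IsRepresentation π ρ μ := by
  have e : mnBracket (structureElement π ρ μ : CochainSpace K (g × V)) (structureElement π ρ μ) =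
      (2 : K) • DirectSum.lof K ℕ (Cochain K (g × V)) (1 + 1)
        (circ 1 1 (liftPi π + liftRho ρ + liftMu μ) (liftPi π + liftRho ρ + liftMu μ)) := by
    refine (mnBracket_lof_lof 1 1 _ _).trans ?_
    rw [mul_one, pow_one]
    module
  rw [e, smul_eq_zero_iff_right two_ne_zero]
  refine lof_eq_zero_iff_two.trans ?_
  have h (x₁ x₂ y : g × V) :=
    compForm_one_one (isConcentrated_toForm_lof (liftPi π + liftRho ρ + liftMu μ))
      (isSkewForm_toForm _) x₁ x₂ y
  rw [← toForm_circ] at h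
  have hs (x y : g × V) : toForm (DirectSum.lof K ℕ (Cochain K (g × V)) 1
      (liftPi π + liftRho ρ + liftMu μ)) [x] y = _ := toForm_structureElement π ρ μ x y
  simp only [hs] at h
  refine (forall₃_congr fun x₁ x₂ y => (iff_of_eq (congrArg (· = 0) (h x₁ x₂ y)))).trans ?_
  simp only [semidirectProduct, Prod.mk_sub_mk, Prod.mk_eq_zero]
  constructor
  · intro H
    refine ⟨fun x y z => ?_, ⟨fun x y => LinearMap.ext fun v => ?_,
      fun x y => LinearMap.ext fun v => ?_⟩⟩
    · have := (H (x, 0) (y, 0) (z, 0)).1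
      simp only [] at this
      linear_combination (norm := module) this
    -- An entry from `V` in the last argument gives the identity for `ρ`, one in the second argument
    -- the identity that relates `μ` and `ρ`.
    · have := (H (x, 0) (y, 0) (0, v)).2
      simp at this
      simp
      linear_combination (norm := module) this
    · have := (H (x, 0) (0, v) (y, 0)).2
      simp at this
      simp
      linear_combination (norm := module) -this
  · rintro ⟨H1, H2, H3⟩ x₁ x₂ y
    refine ⟨?_, ?_⟩
    · have := H1 x₁.1 x₂.1 y.1
      linear_combination (norm := module) this
    · have h1 := LinearMap.congr_fun (H2 x₁.1 x₂.1) y.2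
      have h2 := LinearMap.congr_fun (H3 x₁.1 y.1) x₂.2
      have h3 := LinearMap.congr_fun (H3 x₂.1 y.1) x₁.2
      simp at h1 h2 h3 ⊢
      linear_combination (norm := module) h1 - h2 + h3

theorem mnBracket_structureElement_derivationElement (π : g →ₗ[K] g →ₗ[K] g)
    (ρ μ : g →ₗ[K] Module.End K V) (D : g →ₗ[K] V) :
    mnBracket (structureElement π ρ μ : CochainSpace K (g × V)) (derivationElement D) = 0 ↔
      IsDerivation π ρ μ D := by
  have e : mnBracket (structureElement π ρ μ : CochainSpace K (g × V)) (derivationElement D) =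
      DirectSum.lof K ℕ (Cochain K (g × V)) 1
        (circ 1 0 (liftPi π + liftRho ρ + liftMu μ) (liftD D) -
          circ 0 1 (liftD D) (liftPi π + liftRho ρ + liftMu μ)) := by
    refine (mnBracket_lof_lof 1 0 _ _).trans ?_
    rw [mul_zero, pow_zero, one_smul, map_sub]
  rw [e, lof_eq_zero_iff_one]
  have hM := isConcentrated_toForm_lof (liftPi π + liftRho ρ + liftMu μ : Cochain K (g × V) 1)
  have hN := isConcentrated_toForm_lof (liftD D : Cochain K (g × V) 0)
  have h (x y : g × V) := compForm_one_zero hM hN x y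
  have h' (x y : g × V) := compForm_zero_one
    (M := toForm (DirectSum.lof K ℕ (Cochain K (g × V)) 1 (liftPi π + liftRho ρ + liftMu μ))) hN x y
  rw [← toForm_circ] at h h'
  have hs (x y : g × V) : toForm (DirectSum.lof K ℕ (Cochain K (g × V)) 1
      (liftPi π + liftRho ρ + liftMu μ)) [x] y = _ := toForm_structureElement π ρ μ x y
  have hd (y : g × V) : toForm (DirectSum.lof K ℕ (Cochain K (g × V)) 0 (liftD D)) [] y = _ :=
    toForm_derivationElement D y
  simp only [hs, hd] at h h'
  have key (x y : g × V) : toForm (DirectSum.lof K ℕ (Cochain K (g × V)) 1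
      (circ 1 0 (liftPi π + liftRho ρ + liftMu μ) (liftD D) -
          circ 0 1 (liftD D) (liftPi π + liftRho ρ + liftMu μ))) [x] y =
      (0, μ y.1 (D x.1) + ρ x.1 (D y.1) - D (π x.1 y.1)) := by
    rw [map_sub, toForm_sub, LinearMap.sub_apply]
    refine (congrArg₂ (· - ·) (h x y) (h' x y)).trans ?_
    simp [semidirectProduct]
  simp only [key, Prod.mk_eq_zero, true_and]
  refine ⟨fun H x y => ?_, fun H x y => ?_⟩
  · rw [← sub_eq_zero.1 (H (x, 0) (y, 0)), add_comm]
  · rw [H, sub_eq_zero, add_comm]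

/-- Since only the binary bracket survives, the Maurer–Cartan equation is `½ l_2(α, α) = 0`; its two
components are `[π + ρ + μ, π + ρ + μ] = 0` and `[π + ρ + μ, D] = 0`. -/
theorem isMaurerCartan_control_iff [CharZero K] (π : g →ₗ[K] g →ₗ[K] g)
    (ρ μ : g →ₗ[K] Module.End K V) (D : g →ₗ[K] V) :
    IsMaurerCartan (controlGrading K g V) (controlBracket K g V)
      (structureElement π ρ μ, derivationElement D) ↔ IsPreLieDerPair π ρ μ D := by
  set α : ControlSpace K g V := (structureElement π ρ μ, derivationElement D) with hα
  have hmem : α ∈ controlGrading K g V 0 :=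
    mem_controlGrading.2 ⟨lof_mem_homogeneous _, lof_mem_homogeneous _⟩
  have hvan : ∀ k : ℕ, k ≠ 1 → controlBracket K g V (k + 1) (fun _ => α) = 0 := fun k hk => by
    rw [controlBracket_eq_zero (by omega) (by omega), zero_apply]
  have hfin : {k : ℕ | controlBracket K g V (k + 1) (fun _ => α) ≠ 0}.Finite :=
    (Set.finite_singleton 1).subset fun k hk => by
      by_contra h
      exact hk (hvan k h)
  have hsum : ∑ᶠ k : ℕ, (((k + 1).factorial : K)⁻¹) • controlBracket K g V (k + 1) (fun _ => α) =
      (((1 + 1).factorial : K)⁻¹) • controlBracket K g V 2 (fun _ => α) :=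
    finsum_eq_single _ 1 fun k hk => by rw [hvan k hk, smul_zero]
  obtain ⟨h1, h2⟩ := controlBracket_two_of_mem (x := fun _ => α) (d := fun _ => 0) fun _ => hmem
  have hiff : controlBracket K g V 2 (fun _ => α) = 0 ↔
      mnBracket (structureElement π ρ μ : CochainSpace K (g × V)) (structureElement π ρ μ) = 0 ∧
        mnBracket (structureElement π ρ μ : CochainSpace K (g × V)) (derivationElement D) = 0 := by
    rw [Prod.ext_iff, Subtype.ext_iff, Subtype.ext_iff, h1, h2]
    simp only [hα, mul_zero, Int.negOnePow_zero, one_smul, zero_add, Int.negOnePow_one,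
      Units.neg_smul, Prod.fst_zero, Prod.snd_zero, ZeroMemClass.coe_zero, neg_eq_zero]
    rw [← two_smul K, smul_eq_zero_iff_right two_ne_zero]
  rw [IsMaurerCartan, hsum, smul_eq_zero_iff_right (inv_ne_zero (by norm_num [Nat.factorial])),
    hiff, mnBracket_structureElement, mnBracket_structureElement_derivationElement]
  exact ⟨fun h => ⟨h.2.2.1.1, h.2.2.1.2, h.2.2.2⟩, fun h => ⟨hmem, hfin, ⟨h.1, h.2⟩, h.3⟩⟩

end MaurerCartan
end PreLieDer

theorem mainTheorem1 {K g V : Type*} [Field K] [IsAlgClosed K] [CharZero K]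
    [AddCommGroup g] [Module K g] [AddCommGroup V] [Module K V] :
    PreLieDer.IsLInfinityAlgebra (PreLieDer.controlGrading K g V)
      (PreLieDer.controlBracket K g V) ∧
    (∀ (p p' : ℤ) (f f' : PreLieDer.LPrime K g V),
      (f : PreLieDer.CochainSpace K (g × V)) ∈ PreLieDer.homogeneous K (g × V) p →
      (f' : PreLieDer.CochainSpace K (g × V)) ∈ PreLieDer.homogeneous K (g × V) p' →
      ((PreLieDer.controlBracket K g V 2 ![(f, 0), (f', 0)]).1 :
          PreLieDer.CochainSpace K (g × V)) =
        Int.negOnePow p • PreLieDer.mnBracket (f : PreLieDer.CochainSpace K (g × V)) f' ∧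
      (PreLieDer.controlBracket K g V 2 ![(f, 0), (f', 0)]).2 = 0) ∧
    (∀ (f : PreLieDer.LPrime K g V) (θ : PreLieDer.HSpace K g V),
      (PreLieDer.controlBracket K g V 2 ![(f, 0), (0, θ)]).1 = 0 ∧
      ((PreLieDer.controlBracket K g V 2 ![(f, 0), (0, θ)]).2 :
          PreLieDer.CochainSpace K (g × V)) =
        PreLieDer.projH K g V
          (PreLieDer.mnBracket (f : PreLieDer.CochainSpace K (g × V)) θ)) ∧
    (∀ θ θ' : PreLieDer.HSpace K g V,
      PreLieDer.controlBracket K g V 2 ![(0, θ), (0, θ')] = 0) ∧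
    (∀ k : ℕ, 1 ≤ k → k ≠ 2 → PreLieDer.controlBracket K g V k = 0) ∧
    (∀ (π : g →ₗ[K] g →ₗ[K] g) (ρ μ : g →ₗ[K] Module.End K V) (D : g →ₗ[K] V),
      PreLieDer.IsMaurerCartan (PreLieDer.controlGrading K g V) (PreLieDer.controlBracket K g V)
          (PreLieDer.structureElement π ρ μ, PreLieDer.derivationElement D) ↔
        PreLieDer.IsPreLieDerPair π ρ μ D) := by
  refine ⟨PreLieDer.isLInfinityAlgebra_control, fun p p' f f' hf hf' => ?_, fun f θ => ?_,
    fun θ θ' => ?_, fun k hk hk2 => PreLieDer.controlBracket_eq_zero hk hk2,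
    PreLieDer.isMaurerCartan_control_iff⟩
  · have hx : ∀ i, (![(f, 0), (f', 0)] : Fin 2 → PreLieDer.ControlSpace K g V) i ∈
        PreLieDer.controlGrading K g V (![p - 1, p' - 1] i) := by
      simp [Fin.forall_fin_two, PreLieDer.mem_controlGrading, hf, hf']
    obtain ⟨h1, h2⟩ := PreLieDer.controlBracket_two_of_mem hx
    refine ⟨?_, Subtype.ext ?_⟩
    · rw [h1]
      simp
    · rw [h2]
      simp
  · have h0 : PreLieDer.derivedTerm K g V 1 1 ![(f, 0), (0, θ)] = 0 :=
      PreLieDer.derivedTerm_of_eq_zero rfl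
    refine ⟨Subtype.ext ?_, ?_⟩
    · rw [PreLieDer.controlBracket_two_fst]
      simp
    · rw [PreLieDer.controlBracket_two_snd, PreLieDer.derivedTerm_one_zero, h0, add_zero]
      simp
  · have h0 : PreLieDer.derivedTerm K g V 1 1 ![(0, θ), (0, θ')] = 0 :=
      PreLieDer.derivedTerm_of_eq_zero rfl
    refine Prod.ext (Subtype.ext ?_) (Subtype.ext ?_)
    · rw [PreLieDer.controlBracket_two_fst]
      simp
    · rw [PreLieDer.controlBracket_two_snd, PreLieDer.derivedTerm_one_zero, h0, add_zero]
      simp
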